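/- Let $m\in\mathbb N_0$ and let $(\xi_k)_{k\in\mathbb Z}$ be iid random vectors in $\mathbb R^m$ with $\mathbb E\|\xi_1\|^4<\infty$ and $\mathbb E(\xi_1)=0$. Let $\Sigma_\xi=\mathbb E(\xi_1\xi_1^T)$ and let $\Sigma_\xi^{1/2}\in\mathbb R^{m\times m}$ be any matrix with $\Sigma_\xi^{1/2}(\Sigma_\xi^{1/2})^T=\Sigma_\xi$. Let $(C_j)_{j\in\mathbb Z}$ be matrices in $\mathbb R^{m\times m}$ with $C_j=0$ for $j<0$, $\sum_{j=0}^\infty\|C_j\|<\infty$ and $\sum_{j=0}^\infty j\|C_j\|^2<\infty$, where $\|\cdot\|$ is the operator norm induced by the Euclidean norm. Let $$Y_k=\sum_{j=0}^\infty C_j\xi_{k-j}\quad\text{a.s.},\qquad k\in\mathbb Z .$$ Put $\Gamma_Y(h)=\mathbb E(Y_0Y_h^T)$, $\overline Y_n=\frac1n\sum_{k=1}^nY_k$ and $$\widehat\Gamma_n(h)=\frac1n\sum_{k=1}^{n-h}(Y_k-\overline Y_n)(Y_{k+h}-\overline Y_n)^T\qquad(0\le h\le n-1),$$ with $\widehat\Gamma_n(h)=0$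 for $n\le h$. Let $\otimes$ be the Kronecker product, let $\mathrm{vec}$ stack the columns of a matrix, and let $$\Upsilon^*=\mathbb E\big((\xi_1\otimes\xi_1)(\xi_1\otimes\xi_1)^T\big)-\mathbb E(\xi_1\otimes\xi_1)\,\mathbb E(\xi_1\otimes\xi_1)^T .$$ On some probability space let $N^*(\Upsilon^*)$ be a random $m\times m$ matrix with $\mathrm{vec}(N^*(\Upsilon^*))\sim\mathcal N(0,\Upsilon^*)$, and, independent of it, let $(N_r)_{r\ge1}$ be iid random $m\times m$ matrices with independent standard normal entries. Let $\mathcal H\subset\mathbb N_0$ be finite. Then the series defining $Y_k$ converges absolutely a.s. and $\mathbb E\|Y_k\|^2<\infty$ for every $k\in\mathbb Z$; for every $h\in\mathcal H$ the single series and the two double series below converge absolutely a.s.; and, as $n\to\infty$, jointly in $h\in\mathcal H$, $$\Big(\sqrt n\big(\widehat\Gamma_n(h)-\Gamma_Y(h)\big)\Big)_{h\in\mathcal H}\ \xrightarrow{\ \mathcal D\ }\ \Big(\sum_{j=0}^\infty C_jN^*(\Upsilon^*)C_{j+h}^T+\sum_{j=0}^\infty\Big[\sum_{r=1}^\infty C_j\Sigma_\xi^{1/2}N_r(\Sigma_\xi^{1/2})^TC_{j+r+h}^T\Big]+\sum_{j=0}^\infty\Big[\sum_{r=1}^\infty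 C_j\Sigma_\xi^{1/2}N_r^T(\Sigma_\xi^{1/2})^TC_{j+h-r}^T\Big]\Big)_{h\in\mathcal H}.$$ -/

import Mathlib

open MeasureTheory ProbabilityTheory Filter

/-- Random real matrices are measured entrywise; this is the Borel sigma-algebra (see the next
instance). -/
instance instMeasurableSpaceSqMatrix (m : ℕ) : MeasurableSpace (Matrix (Fin m) (Fin m) ℝ) :=
  inferInstanceAs (MeasurableSpace (Fin m → Fin m → ℝ))

instance instBorelSpaceSqMatrix (m : ℕ) : BorelSpace (Matrix (Fin m) (Fin m) ℝ) :=
  inferInstanceAs (BorelSpace (Fin m → Fin m → ℝ))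

instance instSecondCountableSqMatrix (m : ℕ) :
    SecondCountableTopology (Matrix (Fin m) (Fin m) ℝ) :=
  inferInstanceAs (SecondCountableTopology (Fin m → Fin m → ℝ))

noncomputable section

/-- The operator norm of a square matrix with respect to the Euclidean norm. -/
def opNorm {m : ℕ} (A : Matrix (Fin m) (Fin m) ℝ) : ℝ :=
  ‖Matrix.toEuclideanCLM (𝕜 := ℝ) A‖

/-- The matrix-vector product `A x` on Euclidean space. -/
def applyMat {m : ℕ} (A : Matrix (Fin m) (Fin m) ℝ) (x : EuclideanSpace ℝ (Fin m)) :
    EuclideanSpace ℝ (Fin m) :=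
  Matrix.toEuclideanCLM (𝕜 := ℝ) A x

/-- The matrix `x yᵀ`. -/
def outerProd {m : ℕ} (x y : EuclideanSpace ℝ (Fin m)) : Matrix (Fin m) (Fin m) ℝ :=
  Matrix.vecMulVec x.ofLp y.ofLp

/-- The Kronecker product `x ⊗ y` of two vectors, with coordinates indexed by pairs. -/
def kronVec {m : ℕ} (x y : EuclideanSpace ℝ (Fin m)) : Fin m × Fin m → ℝ :=
  fun p => x p.1 * y p.2

/-- Entrywise expectation of a random matrix. -/
def expMat {Ω ι κ : Type*} [MeasurableSpace Ω] (μ : Measure Ω) (X : Ω → Matrix ι κ ℝ) :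
    Matrix ι κ ℝ :=
  Matrix.of fun i j => ∫ ω, X ω i j ∂μ

/-- Coordinatewise expectation of a random vector. -/
def expVec {Ω ι : Type*} [MeasurableSpace Ω] (μ : Measure Ω) (X : Ω → ι → ℝ) : ι → ℝ :=
  fun i => ∫ ω, X ω i ∂μ

/-- `E((x ⊗ x)(x ⊗ x)ᵀ) - E(x ⊗ x) E(x ⊗ x)ᵀ` for a random vector `x`. -/
def upsilonStar {Ω : Type*} [MeasurableSpace Ω] {m : ℕ} (μ : Measure Ω)
    (x : Ω → EuclideanSpace ℝ (Fin m)) : Matrix (Fin m × Fin m) (Fin m × Fin m) ℝ :=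
  expMat μ (fun ω => Matrix.vecMulVec (kronVec (x ω) (x ω)) (kronVec (x ω) (x ω)))
    - Matrix.vecMulVec (expVec μ fun ω => kronVec (x ω) (x ω))
        (expVec μ fun ω => kronVec (x ω) (x ω))

/-- The autocovariance `E(Y_0 Y_hᵀ)` of a centred stationary process. -/
def autocov {Ω : Type*} [MeasurableSpace Ω] {m : ℕ} (μ : Measure Ω)
    (Y : ℤ → Ω → EuclideanSpace ℝ (Fin m)) (h : ℤ) : Matrix (Fin m) (Fin m) ℝ :=
  expMat μ fun ω => outerProd (Y 0 ω) (Y h ω)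

/-- The sample mean `n⁻¹ ∑_{k=1}^n y_k`. -/
def sampleMean {m : ℕ} (y : ℤ → EuclideanSpace ℝ (Fin m)) (n : ℕ) : EuclideanSpace ℝ (Fin m) :=
  (1 / (n : ℝ)) • ∑ k ∈ Finset.Icc 1 n, y (k : ℤ)

/-- The sample autocovariance at lag `h` of the observations `y_1, …, y_n`
(zero if `n ≤ h`, when the sum is empty). -/
def sampleAutocov {m : ℕ} (y : ℤ → EuclideanSpace ℝ (Fin m)) (n h : ℕ) :
    Matrix (Fin m) (Fin m) ℝ :=
  (1 / (n : ℝ)) • ∑ k ∈ Finset.Icc 1 (n - h),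
    outerProd (y (k : ℤ) - sampleMean y n) (y ((k : ℤ) + (h : ℤ)) - sampleMean y n)

/-- The summand `C_j W C_{j+h}ᵀ`. -/
def diagTerm {m : ℕ} (C : ℤ → Matrix (Fin m) (Fin m) ℝ) (W : Matrix (Fin m) (Fin m) ℝ)
    (h j : ℕ) : Matrix (Fin m) (Fin m) ℝ :=
  C j * W * (C ((j : ℤ) + (h : ℤ))).transpose

/-- The summand `C_j S N_r Sᵀ C_{j+r+h}ᵀ`. -/
def forwardTerm {m : ℕ} (C : ℤ → Matrix (Fin m) (Fin m) ℝ) (S : Matrix (Fin m) (Fin m) ℝ)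
    (N : ℕ+ → Matrix (Fin m) (Fin m) ℝ) (h j : ℕ) (r : ℕ+) : Matrix (Fin m) (Fin m) ℝ :=
  C j * S * N r * S.transpose * (C ((j : ℤ) + ((r : ℕ) : ℤ) + (h : ℤ))).transpose

/-- The summand `C_j S N_rᵀ Sᵀ C_{j+h-r}ᵀ`. -/
def backwardTerm {m : ℕ} (C : ℤ → Matrix (Fin m) (Fin m) ℝ) (S : Matrix (Fin m) (Fin m) ℝ)
    (N : ℕ+ → Matrix (Fin m) (Fin m) ℝ) (h j : ℕ) (r : ℕ+) : Matrix (Fin m) (Fin m) ℝ :=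
  C j * S * (N r).transpose * S.transpose * (C ((j : ℤ) + (h : ℤ) - ((r : ℕ) : ℤ))).transpose

/-- The limit random matrix at lag `h`, as a function of the realisations `W` of the Gaussian
matrix and `N` of the sequence of standard normal matrices. -/
def limitMat {m : ℕ} (C : ℤ → Matrix (Fin m) (Fin m) ℝ) (S W : Matrix (Fin m) (Fin m) ℝ)
    (N : ℕ+ → Matrix (Fin m) (Fin m) ℝ) (h : ℕ) : Matrix (Fin m) (Fin m) ℝ :=
  (∑' j : ℕ, diagTerm C W h j)
    + (∑' j : ℕ, ∑' r : ℕ+, forwardTerm C S N h j r)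
    + (∑' j : ℕ, ∑' r : ℕ+, backwardTerm C S N h j r)

end

open scoped Topology

set_option linter.unusedSectionVars false

/-! ### Characteristic functions, L¹ distance and orthogonal sums. -/

section CharFunTools

variable {Ω : Type*} [MeasurableSpace Ω] {μ : Measure Ω}

/-! Up to an L¹ error of order `n^(-1/2)`, centring at the sample mean is irrelevant, so entry `(a,
b)` of the normalised sample autocovariance may be replaced by `n^(-1/2) ∑_k (Y_k^a Y_{k+h}^b -
Γ_Y(h)_{ab})` (`abs_sqrt_mul_sampleAutocov_sub_le`). Expanding both factors gives a series over `(i,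
c), (j, d)` with weights `C_i(a,c) C_j(b,d)` and normalised sums of the centred noise products
`ξ_{k-i}^c ξ_{k+h-j}^d`. The weights are absolutely summable because `∑ ‖C_j‖` is finite.

The centred products at different later times are orthogonal, whatever their lags. Hence every
normalised sum is bounded in L¹ by one constant, uniformly in `n` and in the offsets, and the series
may be truncated uniformly in `n` (`tendsto_charFun_tsum_mul`). The limit is treated the same way:
its three series are the parts `s = 0`, `s > 0`, `s < 0` of one series over `(i, j)`, with signed
lag `s = j - i - h` (`limitMat_apply_eq_tsum`).

For finitely many terms, shifting all summation windows to `1, …, n` costs `O(n^(-1/2))` in L¹. What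
remains is a sum of a stationary, finite-range, orthogonal sequence. A big-block argument gives its
central limit theorem (`tendsto_charFun_inv_sqrt_mul_sum_window`), and by orthogonality the limit
variance is that of a single summand. That variance is the quadratic form of `lagCov`: lag `0`
contributes `Υ*`, each positive lag contributes `Σ_ξ ⊗ Σ_ξ`, and different lags are uncorrelated.
The Gaussian matrices `N*` and `S N_r Sᵀ` have these same covariances
(`IsLimitNoise.integral_laggedMat_mul`).

All convergence is expressed through characteristic functions, which are Lipschitz in the L¹
distance of the variables. The Cramér–Wold device then handles all entries and lags jointly. -/

theorem norm_charFun_map_sub_le [IsFiniteMeasure μ] {X Y : Ω → ℝ} (hX : AEMeasurable X μ)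
    (hY : AEMeasurable Y μ) (hXY : Integrable (fun ω => X ω - Y ω) μ) (t : ℝ) :
    ‖charFun (μ.map X) t - charFun (μ.map Y) t‖ ≤ |t| * ∫ ω, |X ω - Y ω| ∂μ := by
  rw [charFun_apply_real, charFun_apply_real, integral_map hX (by fun_prop),
    integral_map hY (by fun_prop)]
  have hint : ∀ {Z : Ω → ℝ}, AEMeasurable Z μ →
      Integrable (fun ω => Complex.exp (t * Z ω * Complex.I)) μ := by
    intro Z hZ
    refine Integrable.of_bound (C := 1) (by fun_prop) (ae_of_all _ fun ω => ?_)
    rw [← Complex.ofReal_mul, Complex.norm_exp_ofReal_mul_I]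
  rw [← integral_sub (hint hX) (hint hY), ← integral_const_mul]
  refine norm_integral_le_of_norm_le (hXY.abs.const_mul _) (ae_of_all _ fun ω => ?_)
  have h1 : Complex.exp (t * X ω * Complex.I) - Complex.exp (t * Y ω * Complex.I)
      = Complex.exp ((t * Y ω : ℝ) * Complex.I)
        * (Complex.exp (Complex.I * (t * (X ω - Y ω) : ℝ)) - 1) := by
    rw [mul_sub, ← Complex.exp_add]
    push_cast
    ring_nf
  rw [h1, norm_mul, Complex.norm_exp_ofReal_mul_I, one_mul, ← abs_mul]
  exact Real.norm_exp_I_mul_ofReal_sub_one_le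

/-- A three-epsilon argument in which the approximating sequence may change with `ε`. It serves
block lengths, truncations of series and L¹ replacements alike. -/
theorem tendsto_of_forall_approx {f : ℕ → ℂ} {a : ℂ}
    (h : ∀ ε > 0, ∃ (g : ℕ → ℂ) (b : ℂ), Tendsto g atTop (𝓝 b) ∧ ‖a - b‖ ≤ ε ∧
      ∀ᶠ n in atTop, ‖f n - g n‖ ≤ ε) : Tendsto f atTop (𝓝 a) := by
  rw [Metric.tendsto_nhds]
  intro ε hε
  obtain ⟨g, b, hg, hab, hfg⟩ := h (ε / 4) (by positivity)
  filter_upwards [hfg, Metric.tendsto_nhds.1 hg (ε / 4) (by positivity)] with n h1 h2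
  rw [dist_eq_norm] at h2 ⊢
  have : f n - a = (f n - g n) + (g n - b) - (a - b) := by ring
  rw [this]
  calc _ ≤ ‖f n - g n + (g n - b)‖ + ‖a - b‖ := norm_sub_le _ _
    _ ≤ ‖f n - g n‖ + ‖g n - b‖ + ‖a - b‖ := by gcongr; exact norm_add_le _ _
    _ < ε := by linarith

theorem integral_abs_le_sqrt [IsProbabilityMeasure μ] {X : Ω → ℝ} (hX : MemLp X 2 μ) :
    ∫ ω, |X ω| ∂μ ≤ √(∫ ω, X ω ^ 2 ∂μ) := by
  have h := variance_nonneg (fun ω => |X ω|) μ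
  rw [variance_eq_sub (X := fun ω => |X ω|) hX.abs] at h
  refine Real.le_sqrt_of_sq_le ?_
  simpa using h

theorem integral_sum_sq_of_orthogonal {ι : Type*} (I : Finset ι) {X : ι → Ω → ℝ}
    (hX : ∀ i ∈ I, MemLp (X i) 2 μ)
    (horth : ∀ i ∈ I, ∀ j ∈ I, i ≠ j → ∫ ω, X i ω * X j ω ∂μ = 0) :
    ∫ ω, (∑ i ∈ I, X i ω) ^ 2 ∂μ = ∑ i ∈ I, ∫ ω, X i ω ^ 2 ∂μ := by
  have h1 : ∀ ω, (∑ i ∈ I, X i ω) ^ 2 = ∑ i ∈ I, ∑ j ∈ I, X i ω * X j ω := by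
    intro ω; rw [sq, Finset.sum_mul_sum]
  have hint : ∀ i ∈ I, ∀ j ∈ I, Integrable (fun ω => X i ω * X j ω) μ := fun i hi j hj =>
    (hX i hi).integrable_mul (hX j hj)
  simp_rw [h1]
  rw [integral_finsetSum _ fun i hi => integrable_finsetSum _ (hint i hi)]
  refine Finset.sum_congr rfl fun i hi => ?_
  rw [integral_finsetSum _ (hint i hi), Finset.sum_eq_single_of_mem i hi
    fun j hj hne => horth i hi j hj hne.symm]
  simp [sq]

/-- Pythagoras followed by Cauchy–Schwarz. The square-root growth in the number of terms is exactly
what the factor `1/√n` compensates. -/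
theorem integral_abs_sum_le_of_orthogonal [IsProbabilityMeasure μ] {ι : Type*} (I : Finset ι)
    {X : ι → Ω → ℝ} {v : ℝ} (hX : ∀ i ∈ I, MemLp (X i) 2 μ)
    (horth : ∀ i ∈ I, ∀ j ∈ I, i ≠ j → ∫ ω, X i ω * X j ω ∂μ = 0)
    (hv : ∀ i ∈ I, ∫ ω, X i ω ^ 2 ∂μ ≤ v) :
    ∫ ω, |∑ i ∈ I, X i ω| ∂μ ≤ √(I.card * v) :=
  (integral_abs_le_sqrt (memLp_finsetSum _ hX)).trans
    (Real.sqrt_le_sqrt <| by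
      rw [integral_sum_sq_of_orthogonal I hX horth]
      simpa using Finset.sum_le_card_nsmul I _ v hv)

/-- Independence means that the joint law is an infinite product, and currying turns a product over
`ι × κ` into a product of products. It makes disjoint blocks of an independent sequence independent.
-/
theorem iIndepFun_curry {ι κ E : Type*} [Countable ι] [Countable κ] [MeasurableSpace E]
    [IsProbabilityMeasure μ]
    {X : ι → κ → Ω → E} (hX : ∀ i j, AEMeasurable (X i j) μ)
    (h : iIndepFun (fun (p : ι × κ) ω => X p.1 p.2 ω) μ) :
    iIndepFun (fun i ω j => X i j ω) μ := by
  have : ∀ i j, IsProbabilityMeasure (μ.map (X i j)) :=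
    fun i j => Measure.isProbabilityMeasure_map (hX i j)
  have hm : ∀ i, AEMeasurable (fun ω j => X i j ω) μ := fun i => aemeasurable_pi_lambda _ (hX i)
  rw [iIndepFun_iff_map_fun_eq_infinitePi_map₀' hm]
  have h1 := h.map_fun_eq_infinitePi_map₀' (fun p : ι × κ => hX p.1 p.2)
  have h2 : (fun ω i j => X i j ω)
      = MeasurableEquiv.curry ι κ E ∘ fun ω (p : ι × κ) => X p.1 p.2 ω := by
    ext; rfl
  rw [h2, ← AEMeasurable.map_map_of_aemeasurable (by fun_prop)
    (aemeasurable_pi_lambda _ fun p : ι × κ => hX p.1 p.2), h1,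
    Measure.infinitePi_map_curry (fun i j => μ.map (X i j))]
  congr! 2 with i
  have h3 : iIndepFun (fun j => X i j) μ := h.precomp (g := fun j => (i, j)) (by
    intro a b; simp)
  exact (h3.map_fun_eq_infinitePi_map₀' (hX i)).symm

theorem tendsto_charFun_inv_sqrt_mul_sum_iid [IsProbabilityMeasure μ] {B : ℕ → Ω → ℝ}
    (hB : MemLp (B 0) 2 μ) (h0 : ∫ ω, B 0 ω ∂μ = 0) (hindep : iIndepFun B μ)
    (hident : ∀ k, IdentDistrib (B k) (B 0) μ μ) (t : ℝ) :
    Tendsto (fun n : ℕ => charFun (μ.map fun ω => (√(n : ℝ))⁻¹ * ∑ k ∈ Finset.range n, B k ω) t)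
      atTop (𝓝 (Complex.exp (-((∫ ω, B 0 ω ^ 2 ∂μ : ℝ) * t ^ 2 / 2)))) := by
  have hlaw : HasLaw id (gaussianReal 0 Var[B 0; μ].toNNReal)
      (gaussianReal 0 Var[B 0; μ].toNNReal) := HasLaw.id
  have h := ProbabilityMeasure.tendsto_iff_tendsto_charFun.1
    (tendstoInDistribution_inv_sqrt_mul_sum_sub hlaw hB hindep hident).tendsto t
  have hv : Var[B 0; μ] = ∫ ω, B 0 ω ^ 2 ∂μ := by
    rw [variance_eq_sub hB]; simp [h0]
  simp only [ProbabilityMeasure.coe_mk, Measure.map_id, charFun_gaussianReal, h0, mul_zero,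
    sub_zero] at h
  convert h using 2
  rw [Real.coe_toNNReal _ (variance_nonneg _ _), hv]
  simp

end CharFunTools

/-! ### A central limit theorem for finite-range orthogonal sequences, by blocks. -/

section BlockCLT

variable {Ω : Type*} [MeasurableSpace Ω] {μ : Measure Ω}

theorem eq_of_mul_add_eq_mul_add {L s s' i i' : ℕ} (hi : i < L) (hi' : i' < L)
    (h : s * L + i = s' * L + i') : s = s' := by
  have := congrArg (· / L) h
  simpa only [mul_comm _ L, Nat.mul_add_div (show L > 0 by omega), Nat.div_eq_of_lt hi,
    Nat.div_eq_of_lt hi', add_zero] using this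

/-- Blocks of `u` summands separated by gaps of `R` depend on disjoint stretches of `ζ`, so their
sums are iid, with variance `u * v` by orthogonality. The classical theorem applies to them. The
summands in the gaps and in the incomplete last block form a proportion close to `R / (u + R)` of
all summands, so their normalised sum is small in L¹ once `u` is large. Orthogonality also removes
the covariances that would otherwise enter the limit variance. -/
theorem tendsto_charFun_inv_sqrt_mul_sum_window [IsProbabilityMeasure μ] {E : Type*}
    [MeasurableSpace E] {ζ : ℕ → Ω → E} (hindep : iIndepFun ζ μ)
    (hident : ∀ k, IdentDistrib (ζ k) (ζ 0) μ μ) {R : ℕ} {g : (Fin (R + 1) → E) → ℝ}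
    (hg : Measurable g) {X : ℕ → Ω → ℝ}
    (hXg : ∀ l ω, X l ω = g fun j => ζ (l + j) ω)
    (hX : MemLp (X 0) 2 μ) (h0 : ∫ ω, X 0 ω ∂μ = 0)
    (horth : ∀ k l, k ≠ l → ∫ ω, X k ω * X l ω ∂μ = 0) (t : ℝ) :
    Tendsto (fun n : ℕ => charFun (μ.map fun ω => (√(n : ℝ))⁻¹ * ∑ l ∈ Finset.range n, X l ω) t)
      atTop (𝓝 (Complex.exp (-((∫ ω, X 0 ω ^ 2 ∂μ : ℝ) * t ^ 2 / 2)))) := by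
  set v := ∫ ω, X 0 ω ^ 2 ∂μ with hv
  have hv0 : 0 ≤ v := integral_nonneg fun ω => sq_nonneg _
  have hζm : ∀ k, AEMeasurable (ζ k) μ := fun k => (hident k).aemeasurable_fst
  have hXid : ∀ l, IdentDistrib (X l) (X 0) μ μ := by
    intro l
    have h1 : IdentDistrib (fun ω (j : Fin (R + 1)) => ζ (l + j) ω)
        (fun ω (j : Fin (R + 1)) => ζ (0 + j) ω) μ μ :=
      IdentDistrib.pi (fun j => (hident _).trans (hident _).symm)
        (hindep.precomp (g := fun j : Fin (R + 1) => l + (j : ℕ)) fun a b h => by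
          simpa [Fin.ext_iff] using h)
        (hindep.precomp (g := fun j : Fin (R + 1) => 0 + (j : ℕ)) fun a b h => by
          simpa [Fin.ext_iff] using h)
    have h2 := h1.comp hg
    have e : ∀ k, X k = g ∘ fun ω (j : Fin (R + 1)) => ζ (k + j) ω := fun k => funext (hXg k)
    rw [e l, e 0]
    exact h2
  have hX2 : ∀ l, MemLp (X l) 2 μ := fun l => (hXid l).memLp_iff.2 hX
  have hXm : ∀ l, AEMeasurable (X l) μ := fun l => (hX2 l).aemeasurable
  have hXv : ∀ l, ∫ ω, X l ω ^ 2 ∂μ = v := fun l =>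
    ((hXid l).comp (measurable_id.pow_const 2)).integral_eq
  -- the blocks of length `u`, separated by gaps of length `R`
  let B : ℕ → ℕ → Ω → ℝ := fun u s ω => ∑ w ∈ Finset.range u, X (s * (u + R) + w) ω
  have hBm : ∀ u s, AEMeasurable (B u s) μ := fun u s =>
    Finset.aemeasurable_fun_sum _ fun w _ => hXm _
  have hB2 : ∀ u s, MemLp (B u s) 2 μ := fun u s => memLp_finsetSum _ fun w _ => hX2 _
  have hBv : ∀ u, ∫ ω, B u 0 ω ^ 2 ∂μ = u * v := by
    intro u
    rw [integral_sum_sq_of_orthogonal _ (fun w _ => hX2 _)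
      (fun i _ j _ hij => horth _ _ (by simpa using hij))]
    simp [hXv]
  have hB0 : ∀ u, ∫ ω, B u 0 ω ∂μ = 0 := by
    intro u
    simp only [B]
    rw [integral_finsetSum _ fun w _ => (hX2 _).integrable one_le_two]
    simp [fun l => (hXid l).integral_eq, h0]
  have hblock : ∀ u, iIndepFun (B u) μ ∧ ∀ s, IdentDistrib (B u s) (B u 0) μ μ := by
    intro u
    -- The windows starting at the `u` positions of a block reach at most offset `u - 1 + R`, so a
    -- block sum is a function of exactly `u + R` consecutive `ζ`'s.
    let G : (Fin (u + R) → E) → ℝ := fun y => ∑ w : Fin u, g fun j : Fin (R + 1) =>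
      y ⟨w + j, by have := w.2; have := j.2; omega⟩
    have hG : Measurable G := by fun_prop
    have hBG : ∀ s, B u s = G ∘ fun ω (i : Fin (u + R)) => ζ (s * (u + R) + i) ω := by
      intro s
      ext ω
      simp only [B, G, Function.comp, hXg, Finset.sum_range, add_assoc]
    have hinj : Function.Injective fun p : ℕ × Fin (u + R) => p.1 * (u + R) + (p.2 : ℕ) := by
      rintro ⟨s, i⟩ ⟨s', i'⟩ h
      obtain rfl := eq_of_mul_add_eq_mul_add i.2 i'.2 h
      simpa [Fin.ext_iff] using h
    have hη : iIndepFun (fun s ω (i : Fin (u + R)) => ζ (s * (u + R) + i) ω) μ :=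
      iIndepFun_curry (X := fun s (i : Fin (u + R)) => ζ (s * (u + R) + i)) (fun _ _ => hζm _)
        (hindep.precomp hinj)
    refine ⟨?_, fun s => ?_⟩
    · have := hη.comp (fun _ => G) fun _ => hG
      simpa only [← hBG] using this
    · have h1 : IdentDistrib (fun ω (i : Fin (u + R)) => ζ (s * (u + R) + i) ω)
          (fun ω (i : Fin (u + R)) => ζ (0 * (u + R) + i) ω) μ μ :=
        IdentDistrib.pi (fun j => (hident _).trans (hident _).symm)
          (hindep.precomp (g := fun i : Fin (u + R) => s * (u + R) + (i : ℕ)) fun a b h => by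
            simpa [Fin.ext_iff] using h)
          (hindep.precomp (g := fun i : Fin (u + R) => 0 * (u + R) + (i : ℕ)) fun a b h => by
            simpa [Fin.ext_iff] using h)
      rw [hBG s, hBG 0]
      exact h1.comp hG
  refine tendsto_of_forall_approx fun ε hε => ?_
  -- choice of the block length
  obtain ⟨u, hu1, hu2, hu3⟩ : ∃ u : ℕ, 1 ≤ u ∧ |t| * √(v * (R / (u + R))) ≤ ε / 2 ∧
      ‖Complex.exp (-(v * t ^ 2 / 2)) - Complex.exp (-(v * (u / (u + R) * t ^ 2) / 2))‖ ≤ ε := by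
    have h1 : Tendsto (fun u : ℕ => (R : ℝ) / (u + R)) atTop (𝓝 0) :=
      tendsto_const_nhds.div_atTop
        (tendsto_atTop_add_const_right _ _ tendsto_natCast_atTop_atTop)
    have h2 : Tendsto (fun u : ℕ => (u : ℝ) / (u + R)) atTop (𝓝 1) := by
      have := (tendsto_const_nhds (x := (1 : ℝ))).sub h1
      rw [sub_zero] at this
      refine this.congr' ?_
      filter_upwards [eventually_ge_atTop 1] with u hu
      have : (0 : ℝ) < u := by exact_mod_cast hu
      have : (0 : ℝ) < u + R := by positivity
      field_simp
      ring
    have h3 : Tendsto (fun u : ℕ => |t| * √(v * (R / (u + R)))) atTop (𝓝 0) := by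
      have := ((h1.const_mul v).sqrt).const_mul |t|
      simpa using this
    have h4 : Tendsto (fun u : ℕ => Complex.exp (-(v * t ^ 2 / 2))
        - Complex.exp (-(v * (((u : ℝ) / (u + R) : ℝ) * t ^ 2) / 2))) atTop (𝓝 0) := by
      have h5 : Continuous fun x : ℝ => Complex.exp (-(v * t ^ 2 / 2))
        - Complex.exp (-(v * ((x : ℂ) * t ^ 2) / 2)) := by fun_prop
      have := (h5.tendsto 1).comp h2
      simpa [Function.comp_def] using this
    have e3 := h3.eventually (eventually_le_nhds (show 0 < ε / 2 by positivity))
    have e4 := h4.norm.eventually (eventually_le_nhds (show ‖(0 : ℂ)‖ < ε by simpa using hε))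
    obtain ⟨u, h3, h4, h5⟩ := (e3.and (e4.and (eventually_ge_atTop 1))).exists
    exact ⟨u, h5, h3, by simpa using h4⟩
  set L : ℕ := u + R with hL
  have hLpos : 0 < L := by omega
  have hLr : (L : ℝ) = u + R := by simp [hL]
  have hLr0 : (0 : ℝ) < L := by exact_mod_cast hLpos
  have hTn : Tendsto (fun n : ℕ => ((n / L : ℕ) : ℝ) / n) atTop (𝓝 (1 / L)) := by
    have := (tendsto_nat_floor_mul_div_atTop (R := ℝ) (a := 1 / L) (by positivity)).comp
      tendsto_natCast_atTop_atTop
    refine this.congr fun n => ?_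
    simp only [Function.comp]
    rw [one_div_mul_eq_div, Nat.floor_div_eq_div]
  have hTtop : Tendsto (fun n : ℕ => n / L) atTop atTop := Nat.tendsto_div_const_atTop hLpos.ne'
  -- The number of complete blocks is `n / L`, and `√n` is close to `√L * √(n / L)`; evaluating at
  -- `t / √L` accounts for the factor `√L`.
  have hiid := (tendsto_charFun_inv_sqrt_mul_sum_iid (hB2 u 0) (hB0 u) (hblock u).1
    (hblock u).2 ((√(L : ℝ))⁻¹ * t)).comp hTtop
  refine ⟨_, _, hiid, ?_, ?_⟩
  · refine le_trans (le_of_eq ?_) hu3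
    rw [hBv]
    congr 3
    push_cast
    rw [mul_pow, inv_pow, ← Complex.ofReal_pow, Real.sq_sqrt hLr0.le, hLr]
    push_cast
    ring
  -- `J` collects the positions in the gaps and after the last complete block.
  have hsum : ∀ n : ℕ, ∃ J : Finset ℕ, (J.card : ℝ) = n - (n / L : ℕ) * u ∧
      ∀ ω, ∑ l ∈ Finset.range n, X l ω
        = ∑ s ∈ Finset.range (n / L), B u s ω + ∑ l ∈ J, X l ω := by
    intro n
    have hinj : Set.InjOn (fun p : ℕ × ℕ => p.1 * L + p.2)
        (Finset.range (n / L) ×ˢ Finset.range u : Finset (ℕ × ℕ)) := by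
      rintro ⟨s, i⟩ hs ⟨s', i'⟩ hs' h
      simp only [Finset.coe_product, Set.mem_prod, Finset.coe_range, Set.mem_Iio] at hs hs' h
      have hi : i < L := by omega
      have hi' : i' < L := by omega
      obtain rfl := eq_of_mul_add_eq_mul_add hi hi' h
      simpa using h
    have hsub : (Finset.range (n / L) ×ˢ Finset.range u).image (fun p => p.1 * L + p.2)
        ⊆ Finset.range n := by
      intro l hl
      simp only [Finset.mem_image, Finset.mem_product, Finset.mem_range, Prod.exists] at hl ⊢
      obtain ⟨s, i, ⟨hs, hi⟩, rfl⟩ := hl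
      calc s * L + i < s * L + L := by omega
        _ = (s + 1) * L := by ring
        _ ≤ n / L * L := Nat.mul_le_mul_right _ hs
        _ ≤ n := Nat.div_mul_le_self n L
    refine ⟨Finset.range n \ (Finset.range (n / L) ×ˢ Finset.range u).image
      (fun p => p.1 * L + p.2), ?_, fun ω => ?_⟩
    · have hc := Finset.card_image_of_injOn hinj
      have := Finset.card_sdiff_add_card_eq_card hsub
      rw [hc, Finset.card_product, Finset.card_range, Finset.card_range, Finset.card_range] at this
      rw [eq_sub_iff_add_eq]
      exact_mod_cast this
    · rw [← Finset.sum_sdiff hsub, add_comm, Finset.sum_image hinj, Finset.sum_product]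
  -- The two terms bound the leftover sum over `J` and the mismatch between `1/√n` and `1/(√L √T)`;
  -- only the first survives in the limit.
  have hlim : Tendsto (fun n : ℕ => |t| * (√((1 - ((n / L : ℕ) : ℝ) / n * u) * v)
      + |√(((n / L : ℕ) : ℝ) / n) - (√(L : ℝ))⁻¹| * √(u * v))) atTop
      (𝓝 (|t| * √(v * (R / (u + R))))) := by
    have h1 := ((tendsto_const_nhds (x := (1 : ℝ))).sub (hTn.mul_const (u : ℝ))).mul_const v
    have h2 := ((hTn.sqrt.sub_const (√(L : ℝ))⁻¹).abs).mul_const (√(u * v))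
    have h3 := (h1.sqrt.add h2).const_mul |t|
    convert h3 using 2
    rw [one_div, Real.sqrt_inv, sub_self, abs_zero, zero_mul, add_zero]
    congr 2
    rw [hLr] at hLr0 ⊢
    field_simp
    ring
  have hev := hlim.eventually (eventually_le_nhds (show |t| * √(v * (R / (u + R))) < ε by linarith))
  filter_upwards [hev, eventually_ge_atTop 1] with n hn hn1
  refine le_trans ?_ hn
  obtain ⟨J, hJc, hJ⟩ := hsum n
  have hn0 : (0 : ℝ) < n := by exact_mod_cast hn1
  set T := n / L with hT
  have e1 : charFun (μ.map fun ω => (√(T : ℝ))⁻¹ * ∑ k ∈ Finset.range T, B u k ω)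
      ((√(L : ℝ))⁻¹ * t)
      = charFun (μ.map fun ω => (√(L : ℝ))⁻¹ * ((√(T : ℝ))⁻¹ * ∑ k ∈ Finset.range T, B u k ω))
        t := by
    exact (charFun_map_mul_comp
      ((Finset.aemeasurable_fun_sum _ fun k _ => hBm u k).const_mul _) _ _).symm
  have hS2 : MemLp (fun ω => ∑ k ∈ Finset.range T, B u k ω) 2 μ :=
    memLp_finsetSum _ fun k _ => hB2 u k
  have hJ2 : MemLp (fun ω => ∑ l ∈ J, X l ω) 2 μ := memLp_finsetSum _ fun k _ => hX2 k
  have hBorth : ∀ i j, i ≠ j → ∫ ω, B u i ω * B u j ω ∂μ = 0 := by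
    intro i j hij
    rw [((hblock u).1.indepFun hij).integral_fun_mul_eq_mul_integral
      (hB2 u i).1 (hB2 u j).1, ((hblock u).2 i).integral_eq, hB0 u, zero_mul]
  have b1 : ∫ ω, |∑ l ∈ J, X l ω| ∂μ ≤ √((n - (T : ℕ) * u) * v) := by
    rw [← hJc]
    exact integral_abs_sum_le_of_orthogonal J (fun i _ => hX2 i) (fun i _ j _ => horth i j)
      fun i _ => (hXv i).le
  have b2 : ∫ ω, |∑ k ∈ Finset.range T, B u k ω| ∂μ ≤ √(T * (u * v)) := by
    have := integral_abs_sum_le_of_orthogonal (Finset.range T) (v := u * v)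
      (fun i _ => hB2 u i) (fun i _ j _ => hBorth i j) (fun i _ => by
        rw [← hBv u]
        exact (((hblock u).2 i).comp (measurable_id.pow_const 2)).integral_eq.le)
    simpa using this
  have key : ∀ ω, (√(n : ℝ))⁻¹ * ∑ l ∈ Finset.range n, X l ω
      - (√(L : ℝ))⁻¹ * ((√(T : ℝ))⁻¹ * ∑ k ∈ Finset.range T, B u k ω)
      = (√(n : ℝ))⁻¹ * ∑ l ∈ J, X l ω
        + ((√(n : ℝ))⁻¹ - (√(L : ℝ))⁻¹ * (√(T : ℝ))⁻¹) * ∑ k ∈ Finset.range T, B u k ω := by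
    intro ω; rw [hJ]; ring
  have i1 : Integrable (fun ω => (√(n : ℝ))⁻¹ * ∑ l ∈ J, X l ω) μ :=
    (hJ2.integrable one_le_two).const_mul _
  have i2 : Integrable (fun ω => ((√(n : ℝ))⁻¹ - (√(L : ℝ))⁻¹ * (√(T : ℝ))⁻¹)
      * ∑ k ∈ Finset.range T, B u k ω) μ := (hS2.integrable one_le_two).const_mul _
  simp only [Function.comp]
  rw [← hT, e1]
  refine (norm_charFun_map_sub_le
    ((Finset.aemeasurable_fun_sum _ fun k _ => hXm k).const_mul _)
    (((hS2.aemeasurable).const_mul _).const_mul _) ?_ t).trans ?_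
  · simp_rw [key]
    exact i1.add i2
  refine mul_le_mul_of_nonneg_left ?_ (abs_nonneg t)
  simp_rw [key]
  refine (integral_mono (i1.add i2).abs (i1.abs.add i2.abs) fun ω => abs_add_le _ _).trans ?_
  refine (integral_add i1.abs i2.abs).le.trans ?_
  simp_rw [abs_mul]
  rw [integral_const_mul, integral_const_mul]
  refine add_le_add ?_ ?_
  · calc _ ≤ |(√(n : ℝ))⁻¹| * √((n - (T : ℕ) * u) * v) := by gcongr
      _ = √((1 - (T : ℝ) / n * u) * v) := by
        rw [abs_of_nonneg (by positivity), ← Real.sqrt_inv, ← Real.sqrt_mul (by positivity)]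
        congr 1
        field_simp
  · calc _ ≤ |(√(n : ℝ))⁻¹ - (√(L : ℝ))⁻¹ * (√(T : ℝ))⁻¹| * √(T * (u * v)) := by gcongr
      _ = |√((T : ℝ) / n) - (√(L : ℝ))⁻¹ * ((√(T : ℝ))⁻¹ * √T)| * √(u * v) := by
        rw [Real.sqrt_mul (by positivity), ← mul_assoc]
        nth_rewrite 2 [← abs_of_nonneg (Real.sqrt_nonneg (T : ℝ))]
        rw [← abs_mul, Real.sqrt_div (by positivity)]
        congr 2
        ring
      _ ≤ _ := by
        -- With no complete block, `(√T)⁻¹ * √T` is `0` rather than `1`, but then the left side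
        -- vanishes.
        rcases Nat.eq_zero_or_pos T with h | h
        · rw [h]
          simp
          positivity
        · rw [inv_mul_cancel₀ (by positivity), mul_one]

end BlockCLT

/-! ### Centred products of noise coordinates: orthogonality, L¹ bounds, central limit theorem. -/

section Noise

/-- Centred iid noise with a finite fourth moment. -/
structure IsNoise {Ω : Type*} [MeasurableSpace Ω] {m : ℕ} (ξ : ℤ → Ω → EuclideanSpace ℝ (Fin m))
    (μ : Measure Ω) : Prop where
  indep : iIndepFun ξ μ
  ident : ∀ k, IdentDistrib (ξ k) (ξ 1) μ μ
  moment : MemLp (ξ 1) 4 μ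
  mean : ∫ ω, ξ 1 ω ∂μ = 0

/-- The centred product `ξ_p^a ξ_q^b - E(ξ_p^a ξ_q^b)` of coordinates of the noise. -/
noncomputable def centeredProd {Ω : Type*} [MeasurableSpace Ω] {m : ℕ}
    (ξ : ℤ → Ω → EuclideanSpace ℝ (Fin m)) (μ : Measure Ω) (p : ℤ) (a : Fin m) (q : ℤ) (b : Fin m)
    (ω : Ω) : ℝ :=
  ξ p ω a * ξ q ω b - ∫ ω', ξ p ω' a * ξ q ω' b ∂μ

variable {Ω : Type*} [MeasurableSpace Ω] {μ : Measure Ω} [IsProbabilityMeasure μ] {m : ℕ}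
  {ξ : ℤ → Ω → EuclideanSpace ℝ (Fin m)}

theorem centeredProd_comm (p : ℤ) (a : Fin m) (q : ℤ) (b : Fin m) :
    centeredProd ξ μ p a q b = centeredProd ξ μ q b p a := by
  ext ω; simp only [centeredProd, mul_comm]

namespace IsNoise

theorem aemeasurable (hξ : IsNoise ξ μ) (k : ℤ) : AEMeasurable (ξ k) μ :=
  (hξ.ident k).aemeasurable_fst

theorem memLp (hξ : IsNoise ξ μ) (k : ℤ) : MemLp (ξ k) 4 μ :=
  (hξ.ident k).memLp_iff.2 hξ.moment

theorem memLp_coord (hξ : IsNoise ξ μ) (k : ℤ) (a : Fin m) :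
    MemLp (fun ω => ξ k ω a) 4 μ :=
  (EuclideanSpace.proj (𝕜 := ℝ) a).comp_memLp' (hξ.memLp k)

theorem memLp_mul (hξ : IsNoise ξ μ) (p : ℤ) (a : Fin m) (q : ℤ) (b : Fin m) :
    MemLp (fun ω => ξ p ω a * ξ q ω b) 2 μ := by
  have : ENNReal.HolderTriple 4 4 2 := ⟨by
    have : (4 : ENNReal) = 2 * 2 := by norm_num
    rw [this, ENNReal.mul_inv (by simp) (by simp), ← mul_add, ENNReal.inv_two_add_inv_two, mul_one]⟩
  exact (hξ.memLp_coord q b).mul (hξ.memLp_coord p a)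

theorem integral_coord (hξ : IsNoise ξ μ) (k : ℤ) (a : Fin m) : ∫ ω, ξ k ω a ∂μ = 0 := by
  have h1 : Integrable (ξ k) μ := (hξ.memLp k).integrable (by norm_num)
  have h2 := (EuclideanSpace.proj (𝕜 := ℝ) a).integral_comp_comm h1
  rw [(hξ.ident k).integral_eq, hξ.mean] at h2
  simpa using h2

theorem memLp_centeredProd (hξ : IsNoise ξ μ) (p : ℤ) (a : Fin m) (q : ℤ) (b : Fin m) :
    MemLp (centeredProd ξ μ p a q b) 2 μ :=
  (hξ.memLp_mul p a q b).sub (memLp_const _)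

theorem integrable_centeredProd (hξ : IsNoise ξ μ) (p : ℤ) (a : Fin m) (q : ℤ) (b : Fin m) :
    Integrable (centeredProd ξ μ p a q b) μ :=
  (hξ.memLp_centeredProd p a q b).integrable one_le_two

theorem integral_centeredProd (hξ : IsNoise ξ μ) (p : ℤ) (a : Fin m) (q : ℤ) (b : Fin m) :
    ∫ ω, centeredProd ξ μ p a q b ω ∂μ = 0 := by
  simp only [centeredProd]
  rw [integral_sub ((hξ.memLp_mul p a q b).integrable one_le_two) (integrable_const _)]
  simp

/-- The moment computations below isolate a time index separate from all the others; this lemma then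
factors it out. -/
theorem integral_mul_eq_mul (hξ : IsNoise ξ μ) {l : ℤ} {T : Finset ℤ} (hl : l ∉ T)
    {φ : EuclideanSpace ℝ (Fin m) → ℝ} (hφ : Measurable φ)
    {ψ : (T → EuclideanSpace ℝ (Fin m)) → ℝ} (hψ : Measurable ψ) :
    ∫ ω, φ (ξ l ω) * ψ (fun i => ξ i ω) ∂μ
      = (∫ ω, φ (ξ l ω) ∂μ) * ∫ ω, ψ (fun i => ξ i ω) ∂μ := by
  have h1 := hξ.indep.indepFun_finset₀ {l} T (by simpa using hl) hξ.aemeasurable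
  have h2 := h1.comp (φ := fun y : ({l} : Finset ℤ) → EuclideanSpace ℝ (Fin m) => φ (y ⟨l, by simp⟩))
    (ψ := ψ) (hφ.comp (measurable_pi_apply _)) hψ
  have hm : AEMeasurable (fun ω (i : T) => ξ i ω) μ :=
    aemeasurable_pi_lambda _ fun i => hξ.aemeasurable i
  exact h2.integral_fun_mul_eq_mul_integral
    (hφ.comp_aemeasurable (hξ.aemeasurable l)).aestronglyMeasurable
    (hψ.comp_aemeasurable hm).aestronglyMeasurable

theorem integral_mul_eq_zero (hξ : IsNoise ξ μ) {l : ℤ} {T : Finset ℤ} (hl : l ∉ T)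
    {φ : EuclideanSpace ℝ (Fin m) → ℝ} (hφ : Measurable φ)
    {ψ : (T → EuclideanSpace ℝ (Fin m)) → ℝ} (hψ : Measurable ψ)
    (h0 : ∫ ω, φ (ξ l ω) ∂μ = 0) :
    ∫ ω, φ (ξ l ω) * ψ (fun i => ξ i ω) ∂μ = 0 := by
  rw [hξ.integral_mul_eq_mul hl hφ hψ, h0, zero_mul]

theorem integral_coord_mul (hξ : IsNoise ξ μ) {p q : ℤ} (h : p ≠ q) (a b : Fin m) :
    ∫ ω, ξ p ω a * ξ q ω b ∂μ = 0 :=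
  hξ.integral_mul_eq_zero (l := p) (T := {q}) (by simpa using h) (φ := fun x => x a)
    (ψ := fun y => y ⟨q, by simp⟩ b) (by fun_prop) (by fun_prop) (hξ.integral_coord p a)

/-- The latest time `l` does not occur in the second factor. For `r = 0` the whole first factor is a
centred function of `ξ l`. For `r > 0` the product is uncorrelated, so nothing is subtracted in the
first factor, and the centred coordinate `ξ l a` splits off. -/
theorem integral_centeredProd_mul_of_lt (hξ : IsNoise ξ μ) {l l' : ℤ} (h : l' < l) (r r' : ℕ)
    (a b a' b' : Fin m) :
    ∫ ω, centeredProd ξ μ l a (l - r) b ω * centeredProd ξ μ l' a' (l' - r') b' ω ∂μ = 0 := by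
  set c' := ∫ ω', ξ l' ω' a' * ξ (l' - r') ω' b' ∂μ with hc'
  rcases Nat.eq_zero_or_pos r with rfl | hr
  · have := hξ.integral_mul_eq_zero (l := l) (T := {l', l' - r'})
      (by simp only [Finset.mem_insert, Finset.mem_singleton]; omega)
      (φ := fun x => x a * x b - ∫ ω', ξ l ω' a * ξ l ω' b ∂μ)
      (ψ := fun y => y ⟨l', by simp⟩ a' * y ⟨l' - r', by simp⟩ b' - c')
      (by fun_prop) (by fun_prop) (hξ.integral_centeredProd l a l b)
    simpa [centeredProd] using this
  · have := hξ.integral_mul_eq_zero (l := l) (T := {l - r, l', l' - r'})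
      (by simp only [Finset.mem_insert, Finset.mem_singleton]; omega)
      (φ := fun x => x a)
      (ψ := fun y => y ⟨l - r, by simp⟩ b *
        (y ⟨l', by simp⟩ a' * y ⟨l' - r', by simp⟩ b' - c'))
      (by fun_prop) (by fun_prop) (hξ.integral_coord l a)
    simp only [centeredProd]
    rw [hξ.integral_coord_mul (show l ≠ l - r by omega)]
    simpa only [sub_zero, mul_assoc] using this

theorem integral_centeredProd_mul_of_ne (hξ : IsNoise ξ μ) {l l' : ℤ} (h : l ≠ l') (r r' : ℕ)
    (a b a' b' : Fin m) :
    ∫ ω, centeredProd ξ μ l a (l - r) b ω * centeredProd ξ μ l' a' (l' - r') b' ω ∂μ = 0 := by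
  rcases lt_or_gt_of_ne h with h | h
  · simp_rw [mul_comm (centeredProd ξ μ l a (l - r) b _)]
    exact hξ.integral_centeredProd_mul_of_lt h r' r a' b' a b
  · exact hξ.integral_centeredProd_mul_of_lt h r r' a b a' b'

theorem integrable_norm_pow_four (hξ : IsNoise ξ μ) (k : ℤ) :
    Integrable (fun ω => ‖ξ k ω‖ ^ 4) μ := by
  have := (hξ.memLp k).integrable_norm_pow (p := 4) (by norm_num)
  simpa using this

theorem integral_norm_pow_four (hξ : IsNoise ξ μ) (k : ℤ) :
    ∫ ω, ‖ξ k ω‖ ^ 4 ∂μ = ∫ ω, ‖ξ 1 ω‖ ^ 4 ∂μ :=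
  ((hξ.ident k).comp (u := fun x => ‖x‖ ^ 4) (by fun_prop)).integral_eq

/-- Variance is at most the second moment, and `x²y² ≤ (x⁴ + y⁴)/2` avoids separating `p = q` from
`p ≠ q`. This is where the fourth moment sets the uniform bound. -/
theorem integral_centeredProd_sq_le (hξ : IsNoise ξ μ) (p : ℤ) (a : Fin m) (q : ℤ) (b : Fin m) :
    ∫ ω, centeredProd ξ μ p a q b ω ^ 2 ∂μ ≤ ∫ ω, ‖ξ 1 ω‖ ^ 4 ∂μ := by
  have hm := hξ.memLp_mul p a q b
  have h1 : ∫ ω, centeredProd ξ μ p a q b ω ^ 2 ∂μ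
      = Var[fun ω => ξ p ω a * ξ q ω b; μ] := by
    rw [variance_eq_integral hm.aemeasurable]; rfl
  rw [h1]
  refine (variance_le_expectation_sq hm.1).trans ?_
  have h2 : ∫ ω, ‖ξ 1 ω‖ ^ 4 ∂μ = ∫ ω, (‖ξ p ω‖ ^ 4 + ‖ξ q ω‖ ^ 4) / 2 ∂μ := by
    rw [integral_div, integral_add (hξ.integrable_norm_pow_four p) (hξ.integrable_norm_pow_four q),
      hξ.integral_norm_pow_four p, hξ.integral_norm_pow_four q]
    ring
  rw [h2]
  refine integral_mono hm.integrable_sq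
    (((hξ.integrable_norm_pow_four p).add (hξ.integrable_norm_pow_four q)).div_const 2)
    fun ω => ?_
  have ha : (ξ p ω a) ^ 2 ≤ ‖ξ p ω‖ ^ 2 := by
    rw [← sq_abs, ← Real.norm_eq_abs]; gcongr; exact PiLp.norm_apply_le _ _
  have hb : (ξ q ω b) ^ 2 ≤ ‖ξ q ω‖ ^ 2 := by
    rw [← sq_abs, ← Real.norm_eq_abs]; gcongr; exact PiLp.norm_apply_le _ _
  simp only [Pi.pow_apply]
  calc (ξ p ω a * ξ q ω b) ^ 2 = (ξ p ω a) ^ 2 * (ξ q ω b) ^ 2 := by ring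
    _ ≤ ‖ξ p ω‖ ^ 2 * ‖ξ q ω‖ ^ 2 := by gcongr
    _ ≤ _ := by nlinarith [sq_nonneg (‖ξ p ω‖ ^ 2 - ‖ξ q ω‖ ^ 2)]

theorem integral_abs_sum_centeredProd_le (hξ : IsNoise ξ μ) (I : Finset ℤ) (r : ℕ)
    (a b : Fin m) :
    ∫ ω, |∑ l ∈ I, centeredProd ξ μ l a (l - r) b ω| ∂μ
      ≤ √(I.card * ∫ ω, ‖ξ 1 ω‖ ^ 4 ∂μ) :=
  integral_abs_sum_le_of_orthogonal I (fun _ _ => hξ.memLp_centeredProd _ _ _ _)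
    (fun _ _ _ _ hij => hξ.integral_centeredProd_mul_of_ne hij _ _ _ _ _ _)
    (fun _ _ => hξ.integral_centeredProd_sq_le _ _ _ _)

theorem identDistrib_shift (hξ : IsNoise ξ μ) (s : ℤ) :
    IdentDistrib (fun ω (j : ℤ) => ξ (j + s) ω) (fun ω (j : ℤ) => ξ j ω) μ μ :=
  IdentDistrib.pi (fun _ => (hξ.ident _).trans (hξ.ident _).symm)
    (hξ.indep.precomp (g := fun j => j + s) (add_left_injective s)) hξ.indep

theorem integral_coord_mul_shift (hξ : IsNoise ξ μ) (p q s : ℤ) (a b : Fin m) :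
    ∫ ω, ξ (p + s) ω a * ξ (q + s) ω b ∂μ = ∫ ω, ξ p ω a * ξ q ω b ∂μ :=
  ((hξ.identDistrib_shift s).comp
    (u := fun y : ℤ → EuclideanSpace ℝ (Fin m) => y p a * y q b) (by fun_prop)).integral_eq

end IsNoise

/-- A pair of coordinates, swapped when the offset `s` is negative. -/
def orderedCoords {m : ℕ} (s : ℤ) (c d : Fin m) : Fin m × Fin m :=
  if 0 ≤ s then (c, d) else (d, c)

/-- Normal form by later time and nonnegative lag, at the price of swapping coordinates.
Orthogonality is available only in this form. -/
theorem centeredProd_offset (k p q : ℤ) (c d : Fin m) :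
    centeredProd ξ μ (k + p) c (k + q) d
      = centeredProd ξ μ (k + max p q) (orderedCoords (p - q) c d).1
          (k + max p q - (p - q).natAbs) (orderedCoords (p - q) c d).2 := by
  rcases le_or_gt q p with h | h
  · rw [orderedCoords, if_pos (by omega), max_eq_left h]
    congr 1
    omega
  · rw [orderedCoords, if_neg (by omega), max_eq_right h.le, centeredProd_comm]
    congr 1
    omega

theorem sum_centeredProd_offset (I : Finset ℤ) (p q : ℤ) (c d : Fin m) (ω : Ω) :
    ∑ k ∈ I, centeredProd ξ μ (k + p) c (k + q) d ω
      = ∑ l ∈ I.map (addRightEmbedding (max p q)), centeredProd ξ μ l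
          (orderedCoords (p - q) c d).1 (l - (p - q).natAbs) (orderedCoords (p - q) c d).2 ω := by
  rw [Finset.sum_map]
  exact Finset.sum_congr rfl fun k _ => congrFun (centeredProd_offset k p q c d) ω

namespace IsNoise

theorem integral_abs_sum_centeredProd_offset_le (hξ : IsNoise ξ μ) (I : Finset ℤ) (p q : ℤ)
    (c d : Fin m) :
    ∫ ω, |∑ k ∈ I, centeredProd ξ μ (k + p) c (k + q) d ω| ∂μ
      ≤ √(I.card * ∫ ω, ‖ξ 1 ω‖ ^ 4 ∂μ) := by
  simp_rw [sum_centeredProd_offset]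
  simpa using hξ.integral_abs_sum_centeredProd_le (I.map (addRightEmbedding (max p q)))
    (p - q).natAbs (orderedCoords (p - q) c d).1 (orderedCoords (p - q) c d).2

/-- Shifting the summation window changes the sum by a bounded amount in `L¹`. -/
theorem exists_integral_abs_sum_sub_le (hξ : IsNoise ξ μ) (h : ℕ) (p q : ℤ) (c d : Fin m) :
    ∃ K : ℝ, ∀ n : ℕ, h ≤ n →
      ∫ ω, |∑ k ∈ Finset.Icc (1 : ℤ) (n - h), centeredProd ξ μ (k + p) c (k + q) d ω
        - ∑ l ∈ Finset.Icc (1 : ℤ) n, centeredProd ξ μ l (orderedCoords (p - q) c d).1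
            (l - (p - q).natAbs) (orderedCoords (p - q) c d).2 ω| ∂μ ≤ K := by
  set e := max p q with he
  set M := ∫ ω, ‖ξ 1 ω‖ ^ 4 ∂μ with hM
  have hM0 : 0 ≤ M := integral_nonneg fun ω => by positivity
  refine ⟨√((2 * e.natAbs + h : ℕ) * M) + √((2 * e.natAbs + h : ℕ) * M), fun n hn => ?_⟩
  set f : ℤ → Ω → ℝ := fun l => centeredProd ξ μ l (orderedCoords (p - q) c d).1
            (l - (p - q).natAbs) (orderedCoords (p - q) c d).2 with hf
  set A := (Finset.Icc (1 : ℤ) (n - h)).map (addRightEmbedding e) with hA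
  set B := Finset.Icc (1 : ℤ) n with hB
  have hAe : A = Finset.Icc (1 + e) (n - h + e) := by
    rw [hA, Finset.map_add_right_Icc]
  have key : ∀ ω, ∑ k ∈ Finset.Icc (1 : ℤ) (n - h), centeredProd ξ μ (k + p) c (k + q) d ω
      - ∑ l ∈ B, f l ω = ∑ l ∈ A \ B, f l ω - ∑ l ∈ B \ A, f l ω := by
    intro ω
    rw [sum_centeredProd_offset, Finset.sum_sdiff_sub_sum_sdiff]
  have hint : ∀ I : Finset ℤ, Integrable (fun ω => ∑ l ∈ I, f l ω) μ := fun I =>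
    integrable_finsetSum _ fun l _ => hξ.integrable_centeredProd _ _ _ _
  -- `A` is the window shortened by `h` and moved by `e`, so it differs from `B` only near the two
  -- ends, by a number of points independent of `n`.
  have c1 : (A \ B).card ≤ 2 * e.natAbs + h := by
    have hs : A \ B ⊆ Finset.Icc (1 + e) 0 ∪ Finset.Icc ((n : ℤ) + 1) (n - h + e) := by
      intro x
      simp only [hAe, hB, Finset.mem_sdiff, Finset.mem_Icc, Finset.mem_union]
      omega
    refine (Finset.card_le_card hs).trans ((Finset.card_union_le _ _).trans ?_)
    simp only [Int.card_Icc]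
    omega
  have c2 : (B \ A).card ≤ 2 * e.natAbs + h := by
    have hs : B \ A ⊆ Finset.Icc 1 e ∪ Finset.Icc ((n : ℤ) - h + e + 1) n := by
      intro x
      simp only [hAe, hB, Finset.mem_sdiff, Finset.mem_Icc, Finset.mem_union]
      omega
    refine (Finset.card_le_card hs).trans ((Finset.card_union_le _ _).trans ?_)
    simp only [Int.card_Icc]
    omega
  calc _ = ∫ ω, |∑ l ∈ A \ B, f l ω - ∑ l ∈ B \ A, f l ω| ∂μ :=
        integral_congr_ae (ae_of_all _ fun ω => congrArg abs (key ω))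
    _ ≤ ∫ ω, (|∑ l ∈ A \ B, f l ω| + |∑ l ∈ B \ A, f l ω|) ∂μ :=
        integral_mono ((hint _).sub (hint _)).abs ((hint _).abs.add (hint _).abs)
          fun ω => abs_sub _ _
    _ = ∫ ω, |∑ l ∈ A \ B, f l ω| ∂μ + ∫ ω, |∑ l ∈ B \ A, f l ω| ∂μ :=
        integral_add (hint _).abs (hint _).abs
    _ ≤ _ := by
        refine add_le_add ((hξ.integral_abs_sum_centeredProd_le _ _ _ _).trans ?_)
          ((hξ.integral_abs_sum_centeredProd_le _ _ _ _).trans ?_)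
        · exact Real.sqrt_le_sqrt (mul_le_mul_of_nonneg_right (by exact_mod_cast c1) hM0)
        · exact Real.sqrt_le_sqrt (mul_le_mul_of_nonneg_right (by exact_mod_cast c2) hM0)

/-- The largest lag occurring in `P` is the range `R` of the block theorem; summands at different
times are orthogonal whatever their lags. -/
theorem tendsto_charFun_sum_centeredProd (hξ : IsNoise ξ μ) {ι : Type*} (P : Finset ι)
    (w : ι → ℝ) (r : ι → ℕ) (a b : ι → Fin m) (t : ℝ) :
    Tendsto (fun n : ℕ => charFun (μ.map fun ω => (√(n : ℝ))⁻¹ * ∑ l ∈ Finset.Icc (1 : ℤ) n,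
        ∑ p ∈ P, w p * centeredProd ξ μ l (a p) (l - r p) (b p) ω) t) atTop
      (𝓝 (Complex.exp (-((∫ ω, (∑ p ∈ P,
        w p * centeredProd ξ μ 1 (a p) (1 - r p) (b p) ω) ^ 2 ∂μ : ℝ) * t ^ 2 / 2)))) := by
  set R := P.sup r with hR
  have hrR : ∀ p ∈ P, r p ≤ R := fun p hp => Finset.le_sup hp
  have h2 : ∀ l : ℤ, MemLp (fun ω => ∑ p ∈ P,
      w p * centeredProd ξ μ l (a p) (l - r p) (b p) ω) 2 μ := fun l =>
    memLp_finsetSum _ fun p _ => (hξ.memLp_centeredProd _ _ _ _).const_mul _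
  have hint : ∀ (p : ι) (l : ℤ), Integrable (fun ω => w p *
      centeredProd ξ μ l (a p) (l - r p) (b p) ω) μ := fun p l =>
    (hξ.integrable_centeredProd _ _ _ _).const_mul _
  have hmul : ∀ (p p' : ι) (l l' : ℤ), Integrable (fun ω => (w p *
      centeredProd ξ μ l (a p) (l - r p) (b p) ω) *
      (w p' * centeredProd ξ μ l' (a p') (l' - r p') (b p') ω)) μ := fun p p' l l' =>
    ((hξ.memLp_centeredProd _ _ _ _).const_mul _).integrable_mul
      ((hξ.memLp_centeredProd _ _ _ _).const_mul _)
  have := tendsto_charFun_inv_sqrt_mul_sum_window (μ := μ) (R := R)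
    -- With this shift the window of `ζ` starting at `l` runs from `ξ (l + 1 - R)` to `ξ (l + 1)`:
    -- its last entry is the later time and entry `R - r p` lies `r p` steps earlier. The centring
    -- constant can be taken at time `1` by stationarity.
    (ζ := fun k : ℕ => ξ ((k : ℤ) + 1 - R))
    (g := fun y => ∑ p ∈ P, w p * (y (Fin.last R) (a p) * y ⟨R - r p, by omega⟩ (b p)
      - ∫ ω', ξ 1 ω' (a p) * ξ (1 - r p) ω' (b p) ∂μ))
    (X := fun l ω => ∑ p ∈ P,
      w p * centeredProd ξ μ ((l : ℤ) + 1) (a p) ((l : ℤ) + 1 - r p) (b p) ω)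
    (hξ.indep.precomp (g := fun k : ℕ => (k : ℤ) + 1 - R) fun x y hxy => by
      simp only at hxy; omega)
    (fun k => (hξ.ident _).trans (hξ.ident _).symm) (by fun_prop)
    (fun l ω => Finset.sum_congr rfl fun p hp => by
      have e1 := hξ.integral_coord_mul_shift 1 (1 - r p) l (a p) (b p)
      have e2 : ((l + (Fin.last R : ℕ) : ℕ) : ℤ) + 1 - R = l + 1 := by
        simp only [Fin.val_last]; omega
      have e3 : ((l + (R - r p) : ℕ) : ℤ) + 1 - R = l + 1 - r p := by
        have := hrR p hp; omega
      simp only [centeredProd]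
      rw [e2, e3, ← e1, add_comm (1 : ℤ) l, show (1 - (r p : ℤ) + l) = l + 1 - r p by ring])
    (h2 _)
    (by
      rw [integral_finsetSum _ fun p _ => hint p _]
      refine Finset.sum_eq_zero fun p _ => ?_
      rw [integral_const_mul, hξ.integral_centeredProd, mul_zero])
    (fun k l hkl => by
      simp_rw [Finset.sum_mul_sum]
      rw [integral_finsetSum _ fun p _ => integrable_finsetSum _ fun p' _ => hmul p p' _ _]
      refine Finset.sum_eq_zero fun p _ => ?_
      rw [integral_finsetSum _ fun p' _ => hmul p p' _ _]
      refine Finset.sum_eq_zero fun p' _ => ?_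
      simp_rw [mul_mul_mul_comm (w p)]
      rw [integral_const_mul, hξ.integral_centeredProd_mul_of_ne (by omega), mul_zero])
    t
  refine (this.congr fun n => ?_).trans (by simp)
  congr 2
  ext ω
  congr 1
  have himg : Finset.Icc (1 : ℤ) n
      = (Finset.range n).map ⟨fun k : ℕ => (k : ℤ) + 1, fun x y hxy => by simpa using hxy⟩ := by
    ext x
    simp only [Finset.mem_Icc, Finset.mem_map, Finset.mem_range]
    constructor
    · intro hx
      exact ⟨(x - 1).toNat, by omega, show ((x - 1).toNat : ℤ) + 1 = x by omega⟩
    · rintro ⟨k, hk, rfl⟩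
      change 1 ≤ (k : ℤ) + 1 ∧ (k : ℤ) + 1 ≤ n
      omega
  rw [himg, Finset.sum_map]
  rfl

end IsNoise

end Noise

/-! ### Covariances of the noise products and of the Gaussian limit matrices. -/

section LimitNoise

theorem measurable_matrix_entry {m : ℕ} (i j : Fin m) :
    Measurable fun M : Matrix (Fin m) (Fin m) ℝ => M i j :=
  (measurable_pi_apply j).comp (measurable_pi_apply (X := fun _ : Fin m => Fin m → ℝ) i)

theorem upsilonStar_apply {Ω : Type*} [MeasurableSpace Ω] {m : ℕ} (μ : Measure Ω)
    (x : Ω → EuclideanSpace ℝ (Fin m)) (p q : Fin m × Fin m) :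
    upsilonStar μ x p q = ∫ ω, (x ω p.1 * x ω p.2) * (x ω q.1 * x ω q.2) ∂μ
      - (∫ ω, x ω p.1 * x ω p.2 ∂μ) * ∫ ω, x ω q.1 * x ω q.2 ∂μ := rfl

/-- The covariance of the entries of the noise products at lags `r` and `r'`. -/
def lagCov {m : ℕ} (V : Matrix (Fin m × Fin m) (Fin m × Fin m) ℝ) (Q : Matrix (Fin m) (Fin m) ℝ)
    (r r' : ℕ) (p q : Fin m × Fin m) : ℝ :=
  if r = r' then (if r = 0 then V p q else Q p.1 q.1 * Q p.2 q.2) else 0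

section NoiseCov

variable {Ω : Type*} [MeasurableSpace Ω] {μ : Measure Ω} [IsProbabilityMeasure μ] {m : ℕ}
  {ξ : ℤ → Ω → EuclideanSpace ℝ (Fin m)}

/-- By symmetry `r ≠ 0`; then `l - r` differs from both `l` and `l - r'`, so the centred variable at
that time occurs only once. -/
theorem IsNoise.integral_centeredProd_mul_of_lag_ne (hξ : IsNoise ξ μ) (l : ℤ) {r r' : ℕ}
    (h : r ≠ r') (a b a' b' : Fin m) :
    ∫ ω, centeredProd ξ μ l a (l - r) b ω * centeredProd ξ μ l a' (l - r') b' ω ∂μ = 0 := by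
  wlog hr : r ≠ 0 generalizing r r' a b a' b'
  · have := this h.symm a' b' a b (by omega)
    simpa only [mul_comm] using this
  have := hξ.integral_mul_eq_zero (l := l - r) (T := {l, l - r'})
      (by simp only [Finset.mem_insert, Finset.mem_singleton]; omega)
      (φ := fun x => x b)
      (ψ := fun y => y ⟨l, by simp⟩ a *
        (y ⟨l, by simp⟩ a' * y ⟨l - r', by simp⟩ b'
          - ∫ ω', ξ l ω' a' * ξ (l - r') ω' b' ∂μ))
      (by fun_prop) (by fun_prop) (hξ.integral_coord (l - r) b)
  rw [← this]
  refine integral_congr_ae (ae_of_all _ fun ω => ?_)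
  simp only [centeredProd]
  rw [hξ.integral_coord_mul (show l ≠ l - r by omega)]
  ring

theorem IsNoise.integral_coord_mul_coord (hξ : IsNoise ξ μ) (k : ℤ) (a b : Fin m) :
    ∫ ω, ξ k ω a * ξ k ω b ∂μ = expMat μ (fun ω => outerProd (ξ 1 ω) (ξ 1 ω)) a b :=
  ((hξ.ident k).comp (u := fun x : EuclideanSpace ℝ (Fin m) => x a * x b) (by fun_prop)).integral_eq

/-- At lag `0` this is the covariance of `ξ ⊗ ξ`. At a positive lag the two times are independent
and the moment splits into two entries of `Σ_ξ`. -/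
theorem IsNoise.integral_centeredProd_mul (hξ : IsNoise ξ μ) (r r' : ℕ) (a b a' b' : Fin m) :
    ∫ ω, centeredProd ξ μ 1 a (1 - r) b ω * centeredProd ξ μ 1 a' (1 - r') b' ω ∂μ
      = lagCov (upsilonStar μ (ξ 1)) (expMat μ fun ω => outerProd (ξ 1 ω) (ξ 1 ω)) r r'
        (a, b) (a', b') := by
  rw [lagCov]
  split_ifs with h h0
  · subst h h0
    rw [upsilonStar_apply]
    have := covariance_eq_sub (hξ.memLp_mul 1 a 1 b) (hξ.memLp_mul 1 a' 1 b')
    simpa [covariance, centeredProd] using this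
  · subst h
    have h1 := hξ.integral_mul_eq_mul (l := 1) (T := {(1 : ℤ) - r})
      (by simp only [Finset.mem_singleton]; omega)
      (φ := fun x => x a * x a') (ψ := fun y => y ⟨1 - r, by simp⟩ b * y ⟨1 - r, by simp⟩ b')
      (by fun_prop) (by fun_prop)
    rw [hξ.integral_coord_mul_coord, hξ.integral_coord_mul_coord] at h1
    simp only
    rw [← h1]
    refine integral_congr_ae (ae_of_all _ fun ω => ?_)
    simp only [centeredProd]
    rw [hξ.integral_coord_mul (show (1 : ℤ) ≠ 1 - r by omega),
      hξ.integral_coord_mul (show (1 : ℤ) ≠ 1 - r by omega)]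
    ring
  · exact hξ.integral_centeredProd_mul_of_lag_ne 1 h a b a' b'

/-- A Gram matrix of centred products in L². Positivity is needed to read off the covariance of
`multivariateGaussian`. -/
theorem IsNoise.posSemidef_upsilonStar (hξ : IsNoise ξ μ) :
    (upsilonStar μ (ξ 1)).PosSemidef := by
  have hap : ∀ p q : Fin m × Fin m, upsilonStar μ (ξ 1) p q
      = ∫ ω, centeredProd ξ μ 1 p.1 1 p.2 ω * centeredProd ξ μ 1 q.1 1 q.2 ω ∂μ := by
    intro p q
    have := hξ.integral_centeredProd_mul 0 0 p.1 p.2 q.1 q.2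
    simpa [lagCov] using this.symm
  refine Matrix.PosSemidef.of_dotProduct_mulVec_nonneg ?_ fun x => ?_
  · ext p q
    simp only [Matrix.conjTranspose_apply, star_trivial, hap, mul_comm]
  · have hint : ∀ p q : Fin m × Fin m, Integrable (fun ω => x p * centeredProd ξ μ 1 p.1 1 p.2 ω *
        (x q * centeredProd ξ μ 1 q.1 1 q.2 ω)) μ := fun p q =>
      ((hξ.memLp_centeredProd _ _ _ _).const_mul _).integrable_mul
        ((hξ.memLp_centeredProd _ _ _ _).const_mul _)
    have h1 : star x ⬝ᵥ (upsilonStar μ (ξ 1)).mulVec x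
        = ∫ ω, (∑ p, x p * centeredProd ξ μ 1 p.1 1 p.2 ω) ^ 2 ∂μ := by
      simp_rw [sq, Finset.sum_mul_sum]
      rw [integral_finsetSum _ fun p _ => integrable_finsetSum _ fun q _ => hint p q]
      simp only [dotProduct, Matrix.mulVec, Pi.star_apply, star_trivial, Finset.mul_sum]
      refine Finset.sum_congr rfl fun p _ => ?_
      rw [integral_finsetSum _ fun q _ => hint p q]
      refine Finset.sum_congr rfl fun q _ => ?_
      simp_rw [mul_mul_mul_comm (x p)]
      rw [integral_const_mul, hap]
      ring
    rw [h1]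
    exact integral_nonneg fun ω => sq_nonneg _

end NoiseCov

variable {Ω' : Type*} [MeasurableSpace Ω'] {μ' : Measure Ω'} [IsProbabilityMeasure μ'] {m : ℕ}

/-- `idx` may repeat values, so coefficients are first collected along its fibres; the remaining
summands are independent. -/
theorem hasGaussianLaw_sum_of_iIndepFun {I ι : Type*} {n : I → Ω' → ℝ}
    (hn : ∀ i, HasGaussianLaw (n i) μ') (hind : iIndepFun n μ') (Q : Finset ι) (c : ι → ℝ)
    (idx : ι → I) : HasGaussianLaw (fun ω => ∑ q ∈ Q, c q * n (idx q) ω) μ' := by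
  classical
  have h1 : ∀ ω, ∑ q ∈ Q, c q * n (idx q) ω
      = ∑ i : Q.image idx, (∑ q ∈ Q with idx q = i, c q) * n i ω := by
    intro ω
    rw [Finset.sum_coe_sort (Q.image idx) fun i => (∑ q ∈ Q with idx q = i, c q) * n i ω,
      ← Finset.sum_fiberwise_of_maps_to (t := Q.image idx)
        (fun q hq => Finset.mem_image_of_mem idx hq)]
    refine Finset.sum_congr rfl fun i _ => ?_
    rw [Finset.sum_mul]
    refine Finset.sum_congr rfl fun q hq => ?_
    rw [(Finset.mem_filter.1 hq).2]
  simp_rw [h1]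
  refine iIndepFun.hasGaussianLaw_fun_sum (fun i => ?_) ?_
  · simpa using (hn i).fun_smul (∑ q ∈ Q with idx q = i, c q)
  · exact (hind.precomp (g := fun i : Q.image idx => (i : I)) Subtype.val_injective).comp
      (fun i x => (∑ q ∈ Q with idx q = i, c q) * x) fun i => by fun_prop

/-- The Gaussian matrices from which the limit is built. -/
structure IsLimitNoise (V : Matrix (Fin m × Fin m) (Fin m × Fin m) ℝ)
    (W : Ω' → Matrix (Fin m) (Fin m) ℝ) (N : ℕ+ → Ω' → Matrix (Fin m) (Fin m) ℝ)
    (μ' : Measure Ω') : Prop where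
  posSemidef : V.PosSemidef
  lawW : HasLaw (fun ω => WithLp.toLp 2 (W ω).vec) (multivariateGaussian 0 V) μ'
  lawN : ∀ r i j, HasLaw (fun ω => N r ω i j) (gaussianReal 0 1) μ'
  indepN : iIndepFun
    (fun (p : ℕ+ × Fin m × Fin m) (ω : Ω') => N p.1 ω p.2.1 p.2.2) μ'
  indepWN : IndepFun W (fun ω r => N r ω) μ'

/-- The limit of the normalised sums of noise products at lag `r`. -/
def laggedMat (S W : Matrix (Fin m) (Fin m) ℝ) (N : ℕ+ → Matrix (Fin m) (Fin m) ℝ) (r : ℕ) :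
    Matrix (Fin m) (Fin m) ℝ :=
  if r = 0 then W else S * N r.toPNat' * S.transpose

theorem mul_mul_transpose_apply (S M : Matrix (Fin m) (Fin m) ℝ) (a b : Fin m) :
    (S * M * S.transpose) a b = ∑ q : Fin m × Fin m, (S a q.1 * S b q.2) * M q.1 q.2 := by
  rw [Fintype.sum_prod_type_right]
  simp only [Matrix.mul_apply, Matrix.transpose_apply, Finset.sum_mul]
  exact Finset.sum_congr rfl fun _ _ => Finset.sum_congr rfl fun _ _ => by ring

namespace IsLimitNoise

variable {V : Matrix (Fin m × Fin m) (Fin m × Fin m) ℝ} {W : Ω' → Matrix (Fin m) (Fin m) ℝ}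
  {N : ℕ+ → Ω' → Matrix (Fin m) (Fin m) ℝ} {S : Matrix (Fin m) (Fin m) ℝ}

theorem hasGaussianLaw_W (h : IsLimitNoise V W N μ') :
    HasGaussianLaw (fun ω => WithLp.toLp 2 (W ω).vec) μ' := h.lawW.hasGaussianLaw

theorem hasGaussianLaw_N (h : IsLimitNoise V W N μ') (r : ℕ+) (i j : Fin m) :
    HasGaussianLaw (fun ω => N r ω i j) μ' := (h.lawN r i j).hasGaussianLaw

theorem hasGaussianLaw_W_entry (h : IsLimitNoise V W N μ') (i j : Fin m) :
    HasGaussianLaw (fun ω => W ω i j) μ' :=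
  h.hasGaussianLaw_W.map_fun (EuclideanSpace.proj (𝕜 := ℝ) (j, i))

theorem integral_W (h : IsLimitNoise V W N μ') (i j : Fin m) : ∫ ω, W ω i j ∂μ' = 0 := by
  have h1 := (EuclideanSpace.proj (𝕜 := ℝ) (j, i)).integral_comp_comm h.hasGaussianLaw_W.integrable
  rw [h.lawW.integral_eq, integral_id_multivariateGaussian] at h1
  simpa using h1

/-- The indices appear swapped because `Matrix.vec` stacks columns. The swap is harmless for
`upsilonStar`, which is invariant under exchanging the coordinates in both pairs. -/
theorem integral_W_mul (h : IsLimitNoise V W N μ') (a b a' b' : Fin m) :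
    ∫ ω, W ω a b * W ω a' b' ∂μ' = V (b, a) (b', a') := by
  have h1 := h.lawW.covariance_fun_comp (f := fun x => x (b, a)) (g := fun x => x (b', a'))
    (by fun_prop) (by fun_prop)
  rw [covariance_eval_multivariateGaussian h.posSemidef] at h1
  rw [← h1, covariance_eq_sub]
  · simp [Matrix.vec, h.integral_W]
  · exact (h.hasGaussianLaw_W_entry a b).memLp_two
  · exact (h.hasGaussianLaw_W_entry a' b').memLp_two

theorem integral_N (h : IsLimitNoise V W N μ') (r : ℕ+) (i j : Fin m) :
    ∫ ω, N r ω i j ∂μ' = 0 := by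
  rw [(h.lawN r i j).integral_eq]; simp

theorem integral_N_mul (h : IsLimitNoise V W N μ') (p q : ℕ+ × Fin m × Fin m) :
    ∫ ω, N p.1 ω p.2.1 p.2.2 * N q.1 ω q.2.1 q.2.2 ∂μ' = if p = q then 1 else 0 := by
  split_ifs with hpq
  · subst hpq
    have h1 := (h.lawN p.1 p.2.1 p.2.2).variance_eq
    rw [variance_eq_sub (h.hasGaussianLaw_N _ _ _).memLp_two, h.integral_N] at h1
    simpa [sq] using h1
  · rw [(h.indepN.indepFun hpq).integral_fun_mul_eq_mul_integral
      (h.hasGaussianLaw_N _ _ _).aemeasurable.aestronglyMeasurable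
      (h.hasGaussianLaw_N _ _ _).aemeasurable.aestronglyMeasurable, h.integral_N, zero_mul]

theorem laggedMat_apply_zero (ω : Ω') (a b : Fin m) :
    laggedMat S (W ω) (fun r => N r ω) 0 a b = W ω a b := by simp [laggedMat]

theorem laggedMat_apply_of_ne {r : ℕ} (hr : r ≠ 0) (ω : Ω') (a b : Fin m) :
    laggedMat S (W ω) (fun r => N r ω) r a b
      = ∑ q : Fin m × Fin m, (S a q.1 * S b q.2) * N r.toPNat' ω q.1 q.2 := by
  rw [laggedMat, if_neg hr, mul_mul_transpose_apply]

/-- The lag-zero terms are a linear functional of one Gaussian vector and the others are linear in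
the independent entries of the `N r`. The two parts are independent, so their sum is Gaussian. -/
theorem hasGaussianLaw_sum (h : IsLimitNoise V W N μ') {ι : Type*} (P : Finset ι)
    (w : ι → ℝ) (r : ι → ℕ) (a b : ι → Fin m) :
    HasGaussianLaw (fun ω => ∑ p ∈ P,
      w p * laggedMat S (W ω) (fun r => N r ω) (r p) (a p) (b p)) μ' := by
  have hA : HasGaussianLaw (fun ω => ∑ p ∈ P with r p = 0, w p * W ω (a p) (b p)) μ' := by
    let L : EuclideanSpace ℝ (Fin m × Fin m) →L[ℝ] ℝ :=
      ∑ p ∈ P with r p = 0, w p • EuclideanSpace.proj (𝕜 := ℝ) (b p, a p)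
    have hL : ∀ ω, ∑ p ∈ P with r p = 0, w p * W ω (a p) (b p)
        = L (WithLp.toLp 2 (W ω).vec) := by
      intro ω
      simp [L, Matrix.vec]
    simp_rw [hL]
    exact h.hasGaussianLaw_W.map_fun L
  have hB := hasGaussianLaw_sum_of_iIndepFun (n := fun p : ℕ+ × Fin m × Fin m =>
    fun ω => N p.1 ω p.2.1 p.2.2) (fun p => h.hasGaussianLaw_N _ _ _) h.indepN
    ((P.filter fun p => ¬ r p = 0) ×ˢ (Finset.univ : Finset (Fin m × Fin m)))
    (fun q => w q.1 * (S (a q.1) q.2.1 * S (b q.1) q.2.2))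
    (fun q => ((r q.1).toPNat', q.2))
  have hAB : IndepFun (fun ω => ∑ p ∈ P with r p = 0, w p * W ω (a p) (b p))
      (fun ω => ∑ q ∈ (P.filter fun p => ¬ r p = 0) ×ˢ (Finset.univ : Finset (Fin m × Fin m)),
        w q.1 * (S (a q.1) q.2.1 * S (b q.1) q.2.2) * N (r q.1).toPNat' ω q.2.1 q.2.2) μ' :=
    h.indepWN.comp (φ := fun M : Matrix (Fin m) (Fin m) ℝ => ∑ p ∈ P with r p = 0, w p * M (a p) (b p))
      (ψ := fun y : ℕ+ → Matrix (Fin m) (Fin m) ℝ =>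
        ∑ q ∈ (P.filter fun p => ¬ r p = 0) ×ˢ (Finset.univ : Finset (Fin m × Fin m)),
        w q.1 * (S (a q.1) q.2.1 * S (b q.1) q.2.2) * y (r q.1).toPNat' q.2.1 q.2.2)
      (Finset.measurable_fun_sum _ fun p _ => (measurable_matrix_entry _ _).const_mul _)
      (Finset.measurable_fun_sum _ fun q _ =>
        ((measurable_matrix_entry _ _).comp (measurable_pi_apply _)).const_mul _)
  refine (iIndepFun.hasGaussianLaw_fun_add hA hB hAB).congr (ae_of_all _ fun ω => ?_)
  symm
  simp only
  rw [← Finset.sum_filter_add_sum_filter_not P (fun p => r p = 0), Finset.sum_product]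
  congr 1
  · refine Finset.sum_congr rfl fun p hp => ?_
    rw [(Finset.mem_filter.1 hp).2, laggedMat_apply_zero]
  · refine Finset.sum_congr rfl fun p hp => ?_
    rw [laggedMat_apply_of_ne (Finset.mem_filter.1 hp).2, Finset.mul_sum]
    exact Finset.sum_congr rfl fun _ _ => (mul_assoc _ _ _).symm

theorem hasGaussianLaw_laggedMat (h : IsLimitNoise V W N μ') (r : ℕ) (a b : Fin m) :
    HasGaussianLaw (fun ω => laggedMat S (W ω) (fun r => N r ω) r a b) μ' := by
  simpa using h.hasGaussianLaw_sum (S := S) {()} (fun _ => 1) (fun _ => r) (fun _ => a) fun _ => b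

theorem integral_laggedMat (h : IsLimitNoise V W N μ') (r : ℕ) (a b : Fin m) :
    ∫ ω, laggedMat S (W ω) (fun r => N r ω) r a b ∂μ' = 0 := by
  rcases eq_or_ne r 0 with rfl | hr
  · simp_rw [laggedMat_apply_zero]
    exact h.integral_W a b
  · simp_rw [laggedMat_apply_of_ne hr]
    rw [integral_finsetSum _ fun q _ => (h.hasGaussianLaw_N _ _ _).integrable.const_mul _]
    refine Finset.sum_eq_zero fun q _ => ?_
    rw [integral_const_mul, h.integral_N, mul_zero]

theorem integral_W_mul_N (h : IsLimitNoise V W N μ') (a b c d : Fin m) (r : ℕ+) :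
    ∫ ω, W ω a b * N r ω c d ∂μ' = 0 := by
  have h1 : IndepFun (fun ω => W ω a b) (fun ω => N r ω c d) μ' :=
    h.indepWN.comp (φ := fun M : Matrix (Fin m) (Fin m) ℝ => M a b) (ψ := fun y : ℕ+ → Matrix (Fin m) (Fin m) ℝ => y r c d)
      (measurable_matrix_entry _ _) ((measurable_matrix_entry _ _).comp (measurable_pi_apply _))
  rw [h1.integral_fun_mul_eq_mul_integral
    (h.hasGaussianLaw_W_entry _ _).aemeasurable.aestronglyMeasurable
    (h.hasGaussianLaw_N _ _ _).aemeasurable.aestronglyMeasurable, h.integral_N, mul_zero]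

theorem integral_laggedMat_zero_mul (h : IsLimitNoise V W N μ') {r : ℕ} (hr : r ≠ 0)
    (a b a' b' : Fin m) :
    ∫ ω, laggedMat S (W ω) (fun r => N r ω) 0 a b
      * laggedMat S (W ω) (fun r => N r ω) r a' b' ∂μ' = 0 := by
  simp_rw [laggedMat_apply_zero, laggedMat_apply_of_ne hr, Finset.mul_sum]
  have hm : ∀ q : Fin m × Fin m, ∀ ω, W ω a b * (S a' q.1 * S b' q.2 * N r.toPNat' ω q.1 q.2)
      = (S a' q.1 * S b' q.2) * (W ω a b * N r.toPNat' ω q.1 q.2) := fun q ω => by ring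
  have hint : ∀ q : Fin m × Fin m, Integrable (fun ω =>
      (S a' q.1 * S b' q.2) * (W ω a b * N r.toPNat' ω q.1 q.2)) μ' := fun q =>
    ((h.hasGaussianLaw_W_entry _ _).memLp_two.integrable_mul
      (h.hasGaussianLaw_N _ _ _).memLp_two).const_mul _
  simp_rw [hm]
  rw [integral_finsetSum _ fun q _ => hint q]
  refine Finset.sum_eq_zero fun q _ => ?_
  rw [integral_const_mul, h.integral_W_mul_N, mul_zero]

/-- The matching of second moments: the entries of `S N_r Sᵀ` have covariance `(S Sᵀ) ⊗ (S Sᵀ)`, as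
the noise products do at positive lags. -/
theorem integral_laggedMat_mul (h : IsLimitNoise V W N μ')
    (hV : ∀ a b a' b', V (b, a) (b', a') = V (a, b) (a', b')) (r r' : ℕ)
    (a b a' b' : Fin m) :
    ∫ ω, laggedMat S (W ω) (fun r => N r ω) r a b
      * laggedMat S (W ω) (fun r => N r ω) r' a' b' ∂μ'
      = lagCov V (S * S.transpose) r r' (a, b) (a', b') := by
  rcases eq_or_ne r 0 with rfl | hr
  · rcases eq_or_ne r' 0 with rfl | hr'
    · simp_rw [laggedMat_apply_zero]
      rw [h.integral_W_mul, hV]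
      simp [lagCov]
    · rw [h.integral_laggedMat_zero_mul hr', lagCov, if_neg hr'.symm]
  · rcases eq_or_ne r' 0 with rfl | hr'
    · simp_rw [mul_comm (laggedMat S (W _) (fun r => N r _) r a b)]
      rw [h.integral_laggedMat_zero_mul hr, lagCov, if_neg hr]
    · simp_rw [laggedMat_apply_of_ne hr, laggedMat_apply_of_ne hr', Finset.sum_mul_sum]
      have hm : ∀ q q' : Fin m × Fin m, ∀ ω, (S a q.1 * S b q.2 * N r.toPNat' ω q.1 q.2)
          * (S a' q'.1 * S b' q'.2 * N r'.toPNat' ω q'.1 q'.2)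
          = (S a q.1 * S b q.2) * (S a' q'.1 * S b' q'.2)
            * (N r.toPNat' ω q.1 q.2 * N r'.toPNat' ω q'.1 q'.2) := fun q q' ω => by ring
      simp_rw [hm]
      have hint : ∀ q q' : Fin m × Fin m, Integrable (fun ω =>
          (S a q.1 * S b q.2) * (S a' q'.1 * S b' q'.2)
            * (N r.toPNat' ω q.1 q.2 * N r'.toPNat' ω q'.1 q'.2)) μ' := fun q q' =>
        ((h.hasGaussianLaw_N _ _ _).memLp_two.integrable_mul
          (h.hasGaussianLaw_N _ _ _).memLp_two).const_mul _
      rw [integral_finsetSum _ fun q _ => integrable_finsetSum _ fun q' _ => hint q q']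
      simp_rw [integral_finsetSum _ fun q' _ => hint _ q', integral_const_mul]
      have hN := fun q q' : Fin m × Fin m => h.integral_N_mul (r.toPNat', q) (r'.toPNat', q')
      simp only at hN
      simp_rw [hN]
      rcases eq_or_ne r r' with rfl | hrr
      · rw [lagCov, if_pos rfl, if_neg hr]
        simp only [Prod.mk.injEq, true_and, Matrix.mul_apply, Matrix.transpose_apply]
        rw [Finset.sum_mul_sum, Fintype.sum_prod_type]
        refine Finset.sum_congr rfl fun c _ => Finset.sum_congr rfl fun d _ => ?_
        rw [Finset.sum_eq_single (c, d)]
        · simp; ring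
        · intro q _ hq
          rw [if_neg, mul_zero]
          rintro ⟨rfl⟩
          exact hq rfl
        · simp
      · rw [lagCov, if_neg hrr]
        refine Finset.sum_eq_zero fun q _ => Finset.sum_eq_zero fun q' _ => ?_
        rw [if_neg, mul_zero]
        -- `toPNat'` is injective only away from `0`, which suffices here.
        intro he
        have h1 := congrArg (fun x => (x.1 : ℕ)) he
        simp only [Nat.toPNat'_coe, Nat.pos_of_ne_zero hr, Nat.pos_of_ne_zero hr', if_true]
          at h1
        exact hrr h1

theorem charFun_sum_laggedMat (h : IsLimitNoise V W N μ')
    (hV : ∀ a b a' b', V (b, a) (b', a') = V (a, b) (a', b')) {ι : Type*} (P : Finset ι)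
    (w : ι → ℝ) (r : ι → ℕ) (a b : ι → Fin m) (t : ℝ) :
    charFun (μ'.map fun ω => ∑ p ∈ P,
      w p * laggedMat S (W ω) (fun r => N r ω) (r p) (a p) (b p)) t
      = Complex.exp (-((∑ p ∈ P, ∑ q ∈ P, w p * w q * lagCov V (S * S.transpose) (r p) (r q)
          (a p, b p) (a q, b q) : ℝ) * t ^ 2 / 2)) := by
  have hg := h.hasGaussianLaw_sum (S := S) P w r a b
  rw [hg.map_eq_gaussianReal, charFun_gaussianReal, Real.coe_toNNReal _ (variance_nonneg _ _)]
  have h0 : ∫ ω, ∑ p ∈ P, w p * laggedMat S (W ω) (fun r => N r ω) (r p) (a p) (b p) ∂μ' = 0 := by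
    rw [integral_finsetSum _ fun p _ => (h.hasGaussianLaw_laggedMat _ _ _).integrable.const_mul _]
    refine Finset.sum_eq_zero fun p _ => ?_
    rw [integral_const_mul, h.integral_laggedMat, mul_zero]
  have hint : ∀ p q, Integrable (fun ω =>
      w p * w q * (laggedMat S (W ω) (fun r => N r ω) (r p) (a p) (b p)
        * laggedMat S (W ω) (fun r => N r ω) (r q) (a q) (b q))) μ' := fun p q =>
    ((h.hasGaussianLaw_laggedMat _ _ _).memLp_two.integrable_mul
      (h.hasGaussianLaw_laggedMat _ _ _).memLp_two).const_mul _
  rw [h0, variance_eq_sub hg.memLp_two, h0]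
  have h2 : ∫ ω, (∑ p ∈ P, w p * laggedMat S (W ω) (fun r => N r ω) (r p) (a p) (b p)) ^ 2 ∂μ'
      = ∑ p ∈ P, ∑ q ∈ P, w p * w q * lagCov V (S * S.transpose) (r p) (r q)
          (a p, b p) (a q, b q) := by
    simp_rw [sq, Finset.sum_mul_sum, mul_mul_mul_comm (w _)]
    rw [integral_finsetSum _ fun p _ => integrable_finsetSum _ fun q _ => hint p q]
    refine Finset.sum_congr rfl fun p _ => ?_
    rw [integral_finsetSum _ fun q _ => hint p q]
    refine Finset.sum_congr rfl fun q _ => ?_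
    rw [integral_const_mul, h.integral_laggedMat_mul hV]
  simp only [Pi.pow_apply]
  rw [h2]
  simp

end IsLimitNoise

section

variable {Ω : Type*} [MeasurableSpace Ω] {μ : Measure Ω} [IsProbabilityMeasure μ]
  {ξ : ℤ → Ω → EuclideanSpace ℝ (Fin m)} {S : Matrix (Fin m) (Fin m) ℝ}
  {W : Ω' → Matrix (Fin m) (Fin m) ℝ} {N : ℕ+ → Ω' → Matrix (Fin m) (Fin m) ℝ}

theorem tendsto_charFun_sum_laggedMat (hξ : IsNoise ξ μ)
    (hS : S * S.transpose = expMat μ fun ω => outerProd (ξ 1 ω) (ξ 1 ω))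
    (hWN : IsLimitNoise (upsilonStar μ (ξ 1)) W N μ') {ι : Type*} (P : Finset ι)
    (w : ι → ℝ) (r : ι → ℕ) (a b : ι → Fin m) (t : ℝ) :
    Tendsto (fun n : ℕ => charFun (μ.map fun ω => (√(n : ℝ))⁻¹ * ∑ l ∈ Finset.Icc (1 : ℤ) n,
        ∑ p ∈ P, w p * centeredProd ξ μ l (a p) (l - r p) (b p) ω) t) atTop
      (𝓝 (charFun (μ'.map fun ω => ∑ p ∈ P,
        w p * laggedMat S (W ω) (fun r => N r ω) (r p) (a p) (b p)) t)) := by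
  rw [hWN.charFun_sum_laggedMat (fun a b a' b' => by
    simp only [upsilonStar_apply, mul_comm])]
  have key := hξ.tendsto_charFun_sum_centeredProd P w r a b t
  have hint : ∀ p q, Integrable (fun ω =>
      w p * w q * (centeredProd ξ μ 1 (a p) (1 - r p) (b p) ω
        * centeredProd ξ μ 1 (a q) (1 - r q) (b q) ω)) μ := fun p q =>
    ((hξ.memLp_centeredProd _ _ _ _).integrable_mul (hξ.memLp_centeredProd _ _ _ _)).const_mul _
  have hv : ∫ ω, (∑ p ∈ P, w p * centeredProd ξ μ 1 (a p) (1 - r p) (b p) ω) ^ 2 ∂μ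
      = ∑ p ∈ P, ∑ q ∈ P, w p * w q * lagCov (upsilonStar μ (ξ 1)) (S * S.transpose) (r p) (r q)
          (a p, b p) (a q, b q) := by
    simp_rw [sq, Finset.sum_mul_sum, mul_mul_mul_comm (w _)]
    rw [integral_finsetSum _ fun p _ => integrable_finsetSum _ fun q _ => hint p q]
    refine Finset.sum_congr rfl fun p _ => ?_
    rw [integral_finsetSum _ fun q _ => hint p q]
    refine Finset.sum_congr rfl fun q _ => ?_
    rw [integral_const_mul, hξ.integral_centeredProd_mul, hS]
  rwa [hv] at key

end

end LimitNoise

/-! ### Random series with summable weights and L¹-bounded terms. -/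

section RandomSeries

variable {Ω : Type*} [MeasurableSpace Ω] {μ : Measure Ω} {Q : Type*} [Countable Q]

theorem summable_integral_abs_mul {w : Q → ℝ} (hw : Summable fun q => |w q|) {f : Q → Ω → ℝ}
    {c : ℝ} (hc : ∀ q, ∫ ω, |f q ω| ∂μ ≤ c) :
    Summable fun q => ∫ ω, ‖w q * f q ω‖ ∂μ := by
  refine Summable.of_nonneg_of_le (fun q => integral_nonneg fun ω => norm_nonneg _)
    (fun q => ?_) (hw.mul_right c)
  simp_rw [norm_mul, Real.norm_eq_abs]
  rw [integral_const_mul]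
  exact mul_le_mul_of_nonneg_left (hc q) (abs_nonneg _)

/-- The L¹ norms of the terms are summable, hence the sum of absolute values is almost surely
finite. No independence is involved. -/
theorem ae_summable_abs_mul {w : Q → ℝ} (hw : Summable fun q => |w q|) {f : Q → Ω → ℝ}
    (hf : ∀ q, Integrable (f q) μ) {c : ℝ} (hc : ∀ q, ∫ ω, |f q ω| ∂μ ≤ c) :
    ∀ᵐ ω ∂μ, Summable fun q => |w q * f q ω| := by
  have h1 : ∀ q, Integrable (fun ω => w q * f q ω) μ := fun q => (hf q).const_mul _
  have h2 := summable_norm_of_tsum_eLpNorm_ne_top (μ := μ) (p := 1) le_rfl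
    (f := fun q ω => w q * f q ω) (fun q => (h1 q).1) (by
      simp_rw [eLpNorm_one_eq_lintegral_enorm, ← ofReal_integral_norm_eq_lintegral_enorm (h1 _)]
      exact (summable_integral_abs_mul hw hc).tsum_ofReal_ne_top)
  simpa using h2

theorem lintegral_enorm_tsum_mul_le {w : Q → ℝ} (hw : Summable fun q => |w q|) {f : Q → Ω → ℝ}
    (hf : ∀ q, Integrable (f q) μ) {c : ℝ} (hc : ∀ q, ∫ ω, |f q ω| ∂μ ≤ c) :
    ∫⁻ ω, ‖∑' q, w q * f q ω‖ₑ ∂μ ≤ ENNReal.ofReal (∑' q, ∫ ω, ‖w q * f q ω‖ ∂μ) := by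
  have h1 : ∀ q, Integrable (fun ω => w q * f q ω) μ := fun q => (hf q).const_mul _
  calc ∫⁻ ω, ‖∑' q, w q * f q ω‖ₑ ∂μ ≤ ∫⁻ ω, ∑' q, ‖w q * f q ω‖ₑ ∂μ :=
        lintegral_mono fun ω => enorm_tsum_le_tsum_enorm
    _ = ∑' q, ∫⁻ ω, ‖w q * f q ω‖ₑ ∂μ := lintegral_tsum fun q => (h1 q).1.enorm
    _ = ∑' q, ENNReal.ofReal (∫ ω, ‖w q * f q ω‖ ∂μ) := by
        simp_rw [← ofReal_integral_norm_eq_lintegral_enorm (h1 _)]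
    _ = _ := (ENNReal.ofReal_tsum_of_nonneg (fun q => integral_nonneg fun ω => norm_nonneg _)
        (summable_integral_abs_mul hw hc)).symm

theorem integrable_tsum_mul {w : Q → ℝ} (hw : Summable fun q => |w q|) {f : Q → Ω → ℝ}
    (hf : ∀ q, Integrable (f q) μ) {c : ℝ} (hc : ∀ q, ∫ ω, |f q ω| ∂μ ≤ c) :
    Integrable (fun ω => ∑' q, w q * f q ω) μ :=
  ⟨(AEMeasurable.tsum fun q => ((hf q).const_mul _).aemeasurable).aestronglyMeasurable,
    (lintegral_enorm_tsum_mul_le hw hf hc).trans_lt ENNReal.ofReal_lt_top⟩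

theorem integral_abs_tsum_mul_le {w : Q → ℝ} (hw : Summable fun q => |w q|) {f : Q → Ω → ℝ}
    (hf : ∀ q, Integrable (f q) μ) {c : ℝ} (hc : ∀ q, ∫ ω, |f q ω| ∂μ ≤ c) :
    ∫ ω, |∑' q, w q * f q ω| ∂μ ≤ (∑' q, |w q|) * c := by
  have h0 : 0 ≤ ∑' q, ∫ ω, ‖w q * f q ω‖ ∂μ :=
    tsum_nonneg fun q => integral_nonneg fun ω => norm_nonneg _
  have h1 := lintegral_enorm_tsum_mul_le hw hf hc
  rw [← ofReal_integral_norm_eq_lintegral_enorm (integrable_tsum_mul hw hf hc),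
    ENNReal.ofReal_le_ofReal_iff h0] at h1
  refine h1.trans ?_
  rw [← tsum_mul_right]
  refine (summable_integral_abs_mul hw hc).tsum_le_tsum (fun q => ?_) (hw.mul_right c)
  simp_rw [norm_mul, Real.norm_eq_abs]
  rw [integral_const_mul]
  exact mul_le_mul_of_nonneg_left (hc q) (abs_nonneg _)

theorem integral_tsum_mul {w : Q → ℝ} (hw : Summable fun q => |w q|) {f : Q → Ω → ℝ}
    (hf : ∀ q, Integrable (f q) μ) {c : ℝ} (hc : ∀ q, ∫ ω, |f q ω| ∂μ ≤ c) :
    HasSum (fun q => w q * ∫ ω, f q ω ∂μ) (∫ ω, ∑' q, w q * f q ω ∂μ) := by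
  simpa [integral_const_mul] using hasSum_integral_of_summable_integral_norm
    (fun q => (hf q).const_mul (w q)) (summable_integral_abs_mul hw hc)

theorem integral_abs_tsum_sub_sum_le {w : Q → ℝ} (hw : Summable fun q => |w q|) {f : Q → Ω → ℝ}
    (hf : ∀ q, Integrable (f q) μ) {c : ℝ} (hc : ∀ q, ∫ ω, |f q ω| ∂μ ≤ c) (P : Finset Q) :
    ∫ ω, |∑' q, w q * f q ω - ∑ q ∈ P, w q * f q ω| ∂μ ≤ (∑' q : {q // q ∉ P}, |w q|) * c := by
  have h1 := integral_abs_tsum_mul_le (w := fun q : {q // q ∉ P} => w q)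
    (hw.comp_injective Subtype.val_injective) (f := fun q => f q) (fun q => hf q) (fun q => hc q)
  refine le_trans (le_of_eq (integral_congr_ae ?_)) h1
  filter_upwards [ae_summable_abs_mul hw hf hc] with ω hω
  rw [← hω.of_abs.sum_add_tsum_compl (s := P), add_sub_cancel_left]
  rfl

/-- Convergence of the characteristic functions of random series whose finite partial sums
converge. -/
theorem tendsto_charFun_tsum_mul [IsProbabilityMeasure μ] {Ω' : Type*} [MeasurableSpace Ω']
    {μ' : Measure Ω'} [IsProbabilityMeasure μ'] {w : Q → ℝ} (hw : Summable fun q => |w q|)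
    {f : ℕ → Q → Ω → ℝ} (hf : ∀ n q, Integrable (f n q) μ) {g : Q → Ω' → ℝ}
    (hg : ∀ q, Integrable (g q) μ') {c : ℝ} (hfc : ∀ n q, ∫ ω, |f n q ω| ∂μ ≤ c)
    (hgc : ∀ q, ∫ ω, |g q ω| ∂μ' ≤ c) (t : ℝ)
    (hfin : ∀ P : Finset Q, Tendsto (fun n => charFun (μ.map fun ω => ∑ q ∈ P, w q * f n q ω) t)
      atTop (𝓝 (charFun (μ'.map fun ω => ∑ q ∈ P, w q * g q ω) t))) :
    Tendsto (fun n => charFun (μ.map fun ω => ∑' q, w q * f n q ω) t) atTop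
      (𝓝 (charFun (μ'.map fun ω => ∑' q, w q * g q ω) t)) := by
  refine tendsto_of_forall_approx fun ε hε => ?_
  have hlim : Tendsto (fun P : Finset Q => |t| * ((∑' q : {q // q ∉ P}, |w q|) * c)) atTop
      (𝓝 0) := by
    simpa using ((tendsto_tsum_compl_atTop_zero fun q => |w q|).mul_const c).const_mul |t|
  -- One truncation works for every `n` and for the limit, since the bound `c` is common to all of
  -- them.
  obtain ⟨P, hP⟩ := (hlim.eventually (eventually_le_nhds hε)).exists
  have hfs : ∀ n, Integrable (fun ω => ∑ q ∈ P, w q * f n q ω) μ := fun n =>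
    integrable_finsetSum _ fun q _ => (hf n q).const_mul _
  have hgs : Integrable (fun ω => ∑ q ∈ P, w q * g q ω) μ' :=
    integrable_finsetSum _ fun q _ => (hg q).const_mul _
  refine ⟨_, _, hfin P, ?_, Eventually.of_forall fun n => ?_⟩
  · have hi := integrable_tsum_mul hw hg hgc
    refine (norm_charFun_map_sub_le hi.aemeasurable hgs.aemeasurable (hi.sub hgs) t).trans
      (le_trans ?_ hP)
    exact mul_le_mul_of_nonneg_left (integral_abs_tsum_sub_sum_le hw hg hgc P) (abs_nonneg t)
  · have hi := integrable_tsum_mul hw (hf n) (hfc n)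
    refine (norm_charFun_map_sub_le hi.aemeasurable (hfs n).aemeasurable
      (hi.sub (hfs n)) t).trans (le_trans ?_ hP)
    exact mul_le_mul_of_nonneg_left (integral_abs_tsum_sub_sum_le hw (hf n) (hfc n) P)
      (abs_nonneg t)

theorem tendsto_charFun_of_integral_abs_sub [IsProbabilityMeasure μ] {X Y : ℕ → Ω → ℝ} {a : ℂ}
    (hX : ∀ n, Integrable (X n) μ) (hY : ∀ n, Integrable (Y n) μ) {t : ℝ}
    (h : Tendsto (fun n => charFun (μ.map (Y n)) t) atTop (𝓝 a))
    (hXY : Tendsto (fun n => ∫ ω, |X n ω - Y n ω| ∂μ) atTop (𝓝 0)) :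
    Tendsto (fun n => charFun (μ.map (X n)) t) atTop (𝓝 a) := by
  refine tendsto_of_forall_approx fun ε hε => ⟨_, a, h, by simpa using hε.le, ?_⟩
  have h1 : Tendsto (fun n => |t| * ∫ ω, |X n ω - Y n ω| ∂μ) atTop (𝓝 0) := by
    simpa using hXY.const_mul |t|
  filter_upwards [h1.eventually (eventually_le_nhds hε)] with n hn
  exact (norm_charFun_map_sub_le (hX n).aemeasurable (hY n).aemeasurable
    ((hX n).sub (hY n)) t).trans hn

end RandomSeries

/-! ### Convergence of weighted series of noise sums. -/

section NoiseSeries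

variable {Ω : Type*} [MeasurableSpace Ω] {μ : Measure Ω} [IsProbabilityMeasure μ] {m : ℕ}
  {ξ : ℤ → Ω → EuclideanSpace ℝ (Fin m)}
  {Ω' : Type*} [MeasurableSpace Ω'] {μ' : Measure Ω'} [IsProbabilityMeasure μ']
  {S : Matrix (Fin m) (Fin m) ℝ}
  {W : Ω' → Matrix (Fin m) (Fin m) ℝ} {N : ℕ+ → Ω' → Matrix (Fin m) (Fin m) ℝ}

/-- Uniformity in `r` holds because the variance of an entry takes the same value for all positive
lags; the sum in the witness dominates both that value and the lag-zero one. -/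
theorem IsLimitNoise.exists_integral_abs_laggedMat_le {V : Matrix (Fin m × Fin m) (Fin m × Fin m) ℝ}
    (h : IsLimitNoise V W N μ') (hV : ∀ a b a' b', V (b, a) (b', a') = V (a, b) (a', b')) :
    ∃ c : ℝ, ∀ r a b, ∫ ω, |laggedMat S (W ω) (fun r => N r ω) r a b| ∂μ' ≤ c := by
  refine ⟨√(∑ p : Fin m × Fin m,
    (|V p p| + |(S * S.transpose) p.1 p.1 * (S * S.transpose) p.2 p.2|)), fun r a b => ?_⟩
  refine (integral_abs_le_sqrt (h.hasGaussianLaw_laggedMat r a b).memLp_two).trans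
    (Real.sqrt_le_sqrt ?_)
  simp_rw [sq]
  rw [h.integral_laggedMat_mul hV, lagCov, if_pos rfl]
  refine le_trans ?_ (Finset.single_le_sum
    (f := fun p => |V p p| + |(S * S.transpose) p.1 p.1 * (S * S.transpose) p.2 p.2|)
    (fun p _ => by positivity) (Finset.mem_univ (a, b)))
  split_ifs
  · exact (le_abs_self _).trans (le_add_of_nonneg_right (abs_nonneg _))
  · exact (le_abs_self _).trans (le_add_of_nonneg_left (abs_nonneg _))

theorem IsNoise.integrable_window (hξ : IsNoise ξ μ) (n h : ℕ) (p q : ℤ) (c d : Fin m) :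
    Integrable (fun ω => (√(n : ℝ))⁻¹ *
      ∑ k ∈ Finset.Icc (1 : ℤ) (n - h), centeredProd ξ μ (k + p) c (k + q) d ω) μ :=
  (integrable_finsetSum _ fun _ _ => hξ.integrable_centeredProd _ _ _ _).const_mul _

theorem IsNoise.integral_abs_window_le (hξ : IsNoise ξ μ) (n h : ℕ) (p q : ℤ) (c d : Fin m) :
    ∫ ω, |(√(n : ℝ))⁻¹ *
      ∑ k ∈ Finset.Icc (1 : ℤ) (n - h), centeredProd ξ μ (k + p) c (k + q) d ω| ∂μ
      ≤ √(∫ ω, ‖ξ 1 ω‖ ^ 4 ∂μ) := by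
  simp_rw [abs_mul]
  rw [integral_const_mul, abs_of_nonneg (by positivity)]
  have h0 : 0 ≤ ∫ ω, ‖ξ 1 ω‖ ^ 4 ∂μ := integral_nonneg fun ω => by positivity
  have hc : ((Finset.Icc (1 : ℤ) (n - h)).card : ℝ) ≤ n := by
    rw [Int.card_Icc]
    have : ((n : ℤ) - h + 1 - 1).toNat ≤ n := by omega
    exact_mod_cast this
  calc _ ≤ (√(n : ℝ))⁻¹ * √(n * ∫ ω, ‖ξ 1 ω‖ ^ 4 ∂μ) := by
        gcongr
        exact (hξ.integral_abs_sum_centeredProd_offset_le _ p q c d).trans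
          (Real.sqrt_le_sqrt (mul_le_mul_of_nonneg_right hc h0))
    _ ≤ _ := by
        rw [Real.sqrt_mul (by positivity), ← mul_assoc]
        refine mul_le_of_le_one_left (Real.sqrt_nonneg _) ?_
        exact inv_mul_le_one

/-- Truncation reduces to finitely many terms. For these, each window, with its own offsets and
length, is replaced by `1, …, n` at a bounded L¹ cost, which `1/√n` kills. -/
theorem tendsto_charFun_tsum_window (hξ : IsNoise ξ μ)
    (hS : S * S.transpose = expMat μ fun ω => outerProd (ξ 1 ω) (ξ 1 ω))
    (hWN : IsLimitNoise (upsilonStar μ (ξ 1)) W N μ') {Q : Type*} [Countable Q]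
    {w : Q → ℝ} (hw : Summable fun q => |w q|) (h : Q → ℕ) (p₁ p₂ : Q → ℤ) (c d : Q → Fin m)
    (t : ℝ) :
    Tendsto (fun n : ℕ => charFun (μ.map fun ω => ∑' q, w q * ((√(n : ℝ))⁻¹ *
        ∑ k ∈ Finset.Icc (1 : ℤ) (n - h q),
          centeredProd ξ μ (k + p₁ q) (c q) (k + p₂ q) (d q) ω)) t) atTop
      (𝓝 (charFun (μ'.map fun ω => ∑' q, w q * laggedMat S (W ω) (fun r => N r ω)
        (p₁ q - p₂ q).natAbs (orderedCoords (p₁ q - p₂ q) (c q) (d q)).1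
        (orderedCoords (p₁ q - p₂ q) (c q) (d q)).2) t)) := by
  obtain ⟨c₀, hc₀⟩ := hWN.exists_integral_abs_laggedMat_le (S := S) (fun a b a' b' => by
    simp only [upsilonStar_apply, mul_comm])
  refine tendsto_charFun_tsum_mul hw
    (f := fun n q ω => (√(n : ℝ))⁻¹ * ∑ k ∈ Finset.Icc (1 : ℤ) (n - h q),
          centeredProd ξ μ (k + p₁ q) (c q) (k + p₂ q) (d q) ω)
    (fun n q => hξ.integrable_window _ _ _ _ _ _)
    (fun q => (hWN.hasGaussianLaw_laggedMat _ _ _).integrable)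
    (c := max (√(∫ ω, ‖ξ 1 ω‖ ^ 4 ∂μ)) c₀)
    (fun n q => (hξ.integral_abs_window_le _ _ _ _ _ _).trans (le_max_left _ _))
    (fun q => (hc₀ _ _ _).trans (le_max_right _ _)) t fun P => ?_
  have hY : ∀ n : ℕ, Integrable (fun ω => (√(n : ℝ))⁻¹ * ∑ l ∈ Finset.Icc (1 : ℤ) n,
      ∑ q ∈ P, w q * centeredProd ξ μ l (orderedCoords (p₁ q - p₂ q) (c q) (d q)).1
        (l - (p₁ q - p₂ q).natAbs) (orderedCoords (p₁ q - p₂ q) (c q) (d q)).2 ω) μ := fun n =>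
    (integrable_finsetSum _ fun _ _ => integrable_finsetSum _ fun _ _ =>
      (hξ.integrable_centeredProd _ _ _ _).const_mul _).const_mul _
  refine tendsto_charFun_of_integral_abs_sub (fun n => integrable_finsetSum _ fun q _ =>
    (hξ.integrable_window n _ _ _ _ _).const_mul _) hY
    (tendsto_charFun_sum_laggedMat hξ hS hWN P w _ _ _ t) ?_
  choose K hK using fun q => hξ.exists_integral_abs_sum_sub_le (h q) (p₁ q) (p₂ q) (c q) (d q)
  have hlim : Tendsto (fun n : ℕ => (√(n : ℝ))⁻¹ * ∑ q ∈ P, |w q| * K q) atTop (𝓝 0) := by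
    simpa using ((tendsto_inv_atTop_zero.comp (Real.tendsto_sqrt_atTop.comp
      tendsto_natCast_atTop_atTop)).mul_const (∑ q ∈ P, |w q| * K q))
  refine squeeze_zero' (Eventually.of_forall fun n => integral_nonneg fun ω => abs_nonneg _)
    ?_ hlim
  -- Beyond the largest `h` in `P` the bounds `K q` apply to every term at once.
  filter_upwards [eventually_ge_atTop (P.sup h)] with n hn
  let D : Q → Ω → ℝ := fun q ω =>
    ∑ k ∈ Finset.Icc (1 : ℤ) (n - h q), centeredProd ξ μ (k + p₁ q) (c q) (k + p₂ q) (d q) ω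
      - ∑ l ∈ Finset.Icc (1 : ℤ) n, centeredProd ξ μ l
          (orderedCoords (p₁ q - p₂ q) (c q) (d q)).1
          (l - (p₁ q - p₂ q).natAbs) (orderedCoords (p₁ q - p₂ q) (c q) (d q)).2 ω
  have hD : ∀ q, Integrable (D q) μ := fun q =>
    (integrable_finsetSum _ fun _ _ => hξ.integrable_centeredProd _ _ _ _).sub
      (integrable_finsetSum _ fun _ _ => hξ.integrable_centeredProd _ _ _ _)
  calc _ = ∫ ω, |(√(n : ℝ))⁻¹ * ∑ q ∈ P, w q * D q ω| ∂μ := by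
        refine integral_congr_ae (ae_of_all _ fun ω => congrArg abs ?_)
        simp only [D, mul_sub, Finset.sum_sub_distrib]
        congr 1
        · rw [Finset.mul_sum]
          exact Finset.sum_congr rfl fun q _ => by ring
        · rw [Finset.sum_comm]
          simp only [Finset.mul_sum]
    _ ≤ ∫ ω, (√(n : ℝ))⁻¹ * ∑ q ∈ P, |w q| * |D q ω| ∂μ := by
        refine integral_mono ((integrable_finsetSum _ fun q _ => (hD q).const_mul _).const_mul
          _).abs ((integrable_finsetSum _ fun q _ => (hD q).abs.const_mul _).const_mul _)
          fun ω => ?_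
        simp only
        rw [abs_mul, abs_of_nonneg (by positivity)]
        gcongr
        exact (Finset.abs_sum_le_sum_abs _ _).trans (Finset.sum_le_sum fun q _ =>
          (abs_mul _ _).le)
    _ = (√(n : ℝ))⁻¹ * ∑ q ∈ P, |w q| * ∫ ω, |D q ω| ∂μ := by
        rw [integral_const_mul, integral_finsetSum _ fun q _ => (hD q).abs.const_mul _]
        simp_rw [integral_const_mul]
    _ ≤ _ := by
        gcongr with q hq
        exact hK q n ((Finset.le_sup hq).trans hn)

end NoiseSeries

/-! ### Operator norm, matrix entries and entrywise sums. -/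

section OpNorm

variable {m : ℕ}

theorem opNorm_nonneg (A : Matrix (Fin m) (Fin m) ℝ) : 0 ≤ opNorm A := norm_nonneg _

theorem opNorm_mul_le (A B : Matrix (Fin m) (Fin m) ℝ) : opNorm (A * B) ≤ opNorm A * opNorm B := by
  rw [opNorm, map_mul]; exact norm_mul_le _ _

theorem opNorm_transpose (A : Matrix (Fin m) (Fin m) ℝ) : opNorm A.transpose = opNorm A := by
  have : A.transpose = star A := by
    rw [Matrix.star_eq_conjTranspose, Matrix.conjTranspose_eq_transpose_of_trivial]
  rw [opNorm, this, map_star, ContinuousLinearMap.star_eq_adjoint]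
  exact LinearIsometryEquiv.norm_map _ _

theorem opNorm_zero : opNorm (0 : Matrix (Fin m) (Fin m) ℝ) = 0 := by simp [opNorm]

theorem opNorm_mul_mul_transpose_le (A B M : Matrix (Fin m) (Fin m) ℝ) :
    opNorm (A * M * B.transpose) ≤ opNorm A * opNorm B * opNorm M := by
  calc _ ≤ opNorm A * opNorm M * opNorm B := by
        refine (opNorm_mul_le _ _).trans ?_
        rw [opNorm_transpose]
        exact mul_le_mul_of_nonneg_right (opNorm_mul_le _ _) (opNorm_nonneg _)
    _ = _ := by ring

theorem applyMat_apply (A : Matrix (Fin m) (Fin m) ℝ) (x : EuclideanSpace ℝ (Fin m)) (a : Fin m) :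
    applyMat A x a = ∑ c, A a c * x c := by
  simp [applyMat, Matrix.mulVec, dotProduct]

theorem norm_applyMat_le (A : Matrix (Fin m) (Fin m) ℝ) (x : EuclideanSpace ℝ (Fin m)) :
    ‖applyMat A x‖ ≤ opNorm A * ‖x‖ :=
  ContinuousLinearMap.le_opNorm _ _

theorem abs_entry_le_opNorm (A : Matrix (Fin m) (Fin m) ℝ) (a b : Fin m) :
    |A a b| ≤ opNorm A := by
  have h1 := norm_applyMat_le A (EuclideanSpace.single b 1)
  have h2 := PiLp.norm_apply_le (applyMat A (EuclideanSpace.single b 1)) a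
  rw [applyMat_apply] at h2
  simp at h1 h2
  exact h2.trans h1

theorem opNorm_le_sum_abs (A : Matrix (Fin m) (Fin m) ℝ) :
    opNorm A ≤ ∑ p : Fin m × Fin m, |A p.1 p.2| := by
  refine ContinuousLinearMap.opNorm_le_bound _ (Finset.sum_nonneg fun _ _ => abs_nonneg _)
    fun x => ?_
  have h1 : ∀ y : EuclideanSpace ℝ (Fin m), ‖y‖ ≤ ∑ a, |y a| := by
    intro y
    rw [EuclideanSpace.norm_eq]
    refine Real.sqrt_le_iff.2 ⟨Finset.sum_nonneg fun _ _ => abs_nonneg _, ?_⟩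
    exact Finset.sum_sq_le_sq_sum_of_nonneg fun _ _ => abs_nonneg _
  refine (h1 _).trans ?_
  rw [Fintype.sum_prod_type, Finset.sum_mul]
  refine Finset.sum_le_sum fun a _ => ?_
  change |applyMat A x a| ≤ _
  rw [applyMat_apply, Finset.sum_mul]
  refine (Finset.abs_sum_le_sum_abs _ _).trans (Finset.sum_le_sum fun c _ => ?_)
  rw [abs_mul]
  exact mul_le_mul_of_nonneg_left (PiLp.norm_apply_le x c) (abs_nonneg _)

theorem tsum_matrix_apply {ι : Type*} {f : ι → Matrix (Fin m) (Fin m) ℝ}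
    (hf : ∀ a b, Summable fun i => f i a b) (a b : Fin m) :
    (∑' i, f i) a b = ∑' i, f i a b := by
  have h1 : Summable f := Pi.summable.2 fun a => Pi.summable.2 fun b => hf a b
  have h2 : Summable fun i => f i a := Pi.summable.2 fun b => hf a b
  have e1 : (∑' i, f i) a = ∑' i, f i a := tsum_apply h1
  rw [e1]
  exact tsum_apply h2

theorem tsum_tsum_matrix_apply {ι κ : Type*} {f : ι → κ → Matrix (Fin m) (Fin m) ℝ}
    (hf : Summable fun q : ι × κ => opNorm (f q.1 q.2)) (a b : Fin m) :
    (∑' i, ∑' j, f i j) a b = ∑' i, ∑' j, f i j a b := by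
  have h1 : ∀ a b, Summable fun q : ι × κ => f q.1 q.2 a b := fun a b =>
    Summable.of_norm_bounded hf fun q => abs_entry_le_opNorm _ _ _
  have h2 : ∀ i a b, (∑' j, f i j) a b = ∑' j, f i j a b := fun i =>
    tsum_matrix_apply fun a b => (h1 a b).prod_factor i
  rw [tsum_matrix_apply]
  · simp_rw [h2]
  · intro a b
    simp_rw [h2]
    exact (h1 a b).prod

end OpNorm

/-! ### The limit matrix as a single series over pairs of integers. -/

section LimitSeries

variable {m : ℕ} {C : ℤ → Matrix (Fin m) (Fin m) ℝ} {S : Matrix (Fin m) (Fin m) ℝ}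

theorem summable_opNorm_int (hC_neg : ∀ j < 0, C j = 0)
    (hC_abs : Summable fun j : ℕ => opNorm (C j)) : Summable fun j : ℤ => opNorm (C j) := by
  refine (Function.Injective.summable_iff Nat.cast_injective fun j hj => ?_).1 hC_abs
  rw [hC_neg j, opNorm_zero]
  by_contra h
  exact hj ⟨j.toNat, by simp; omega⟩

theorem tsum_nat_eq_tsum_int {f : ℤ → ℝ} (hf : ∀ j < 0, f j = 0) :
    ∑' j : ℕ, f j = ∑' j : ℤ, f j := by
  refine Function.Injective.tsum_eq Nat.cast_injective fun j hj => ?_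
  by_contra h
  refine hj (hf j ?_)
  by_contra h'
  exact h ⟨j.toNat, by simp; omega⟩

/-- The limit matrix at the signed lag `s`. -/
def signedLaggedMat (S W : Matrix (Fin m) (Fin m) ℝ) (N : ℕ+ → Matrix (Fin m) (Fin m) ℝ) (s : ℤ) :
    Matrix (Fin m) (Fin m) ℝ :=
  if 0 ≤ s then laggedMat S W N s.natAbs else (laggedMat S W N s.natAbs).transpose

theorem signedLaggedMat_apply (S W : Matrix (Fin m) (Fin m) ℝ)
    (N : ℕ+ → Matrix (Fin m) (Fin m) ℝ) (s : ℤ) (c d : Fin m) :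
    signedLaggedMat S W N s c d = laggedMat S W N s.natAbs (orderedCoords s c d).1
      (orderedCoords s c d).2 := by
  rw [signedLaggedMat, orderedCoords]
  split_ifs <;> rfl

theorem toPNat'_coe_pnat (r : ℕ+) : (r : ℕ).toPNat' = r := PNat.coe_toPNat' r

/-- The general summand of the limit. -/
def limitTerm (C : ℤ → Matrix (Fin m) (Fin m) ℝ) (S W : Matrix (Fin m) (Fin m) ℝ)
    (N : ℕ+ → Matrix (Fin m) (Fin m) ℝ) (h : ℕ) (i j : ℤ) : Matrix (Fin m) (Fin m) ℝ :=
  C i * signedLaggedMat S W N (j - i - h) * (C j).transpose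

/-- The signed lag is `0` here, `r` for the forward terms and `-r` for the backward terms, where `(S
N_r Sᵀ)ᵀ = S N_rᵀ Sᵀ`. -/
theorem diagTerm_eq (W : Matrix (Fin m) (Fin m) ℝ) (N : ℕ+ → Matrix (Fin m) (Fin m) ℝ) (h j : ℕ) :
    diagTerm C W h j = limitTerm C S W N h j (j + h) := by
  simp [diagTerm, limitTerm, signedLaggedMat, laggedMat]

theorem forwardTerm_eq (W : Matrix (Fin m) (Fin m) ℝ) (N : ℕ+ → Matrix (Fin m) (Fin m) ℝ)
    (h j : ℕ) (r : ℕ+) :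
    forwardTerm C S N h j r = limitTerm C S W N h j (j + h + (r : ℕ)) := by
  have h1 : (j : ℤ) + h + (r : ℕ) - j - h = (r : ℕ) := by ring
  have h2 : (j : ℤ) + (r : ℕ) + h = j + h + (r : ℕ) := by ring
  rw [forwardTerm, limitTerm, h1, h2, signedLaggedMat, if_pos (by positivity), Int.natAbs_natCast,
    laggedMat, if_neg r.ne_zero, toPNat'_coe_pnat]
  simp only [Matrix.mul_assoc]

theorem backwardTerm_eq (W : Matrix (Fin m) (Fin m) ℝ) (N : ℕ+ → Matrix (Fin m) (Fin m) ℝ)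
    (h j : ℕ) (r : ℕ+) :
    backwardTerm C S N h j r = limitTerm C S W N h j (j + h + -((r : ℕ) : ℤ)) := by
  have h1 : (j : ℤ) + h + -((r : ℕ) : ℤ) - j - h = -((r : ℕ) : ℤ) := by ring
  have hr := r.pos
  rw [backwardTerm, limitTerm, h1, signedLaggedMat, if_neg (by omega), Int.natAbs_neg,
    Int.natAbs_natCast, laggedMat, if_neg r.ne_zero, toPNat'_coe_pnat, ← sub_eq_add_neg]
  simp only [Matrix.mul_assoc, Matrix.transpose_mul, Matrix.transpose_transpose]

section

variable {W : Matrix (Fin m) (Fin m) ℝ} {N : ℕ+ → Matrix (Fin m) (Fin m) ℝ} {h : ℕ}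

theorem summable_opNorm_diagTerm
    (hs : Summable fun q : ℤ × ℤ => opNorm (limitTerm C S W N h q.1 q.2)) :
    Summable fun j : ℕ => opNorm (diagTerm C W h j) := by
  simp_rw [diagTerm_eq (S := S) W N]
  exact hs.comp_injective (i := fun j : ℕ => ((j : ℤ), (j : ℤ) + h)) fun a b hab => by
    simpa using hab

theorem summable_opNorm_forwardTerm
    (hs : Summable fun q : ℤ × ℤ => opNorm (limitTerm C S W N h q.1 q.2)) :
    Summable fun q : ℕ × ℕ+ => opNorm (forwardTerm C S N h q.1 q.2) := by
  simp_rw [forwardTerm_eq W N]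
  exact hs.comp_injective (i := fun q : ℕ × ℕ+ => ((q.1 : ℤ), (q.1 : ℤ) + h + (q.2 : ℕ)))
    fun a b hab => by
      simp only [Prod.mk.injEq, Nat.cast_inj] at hab
      obtain ⟨h1, h2⟩ := hab
      rw [h1] at h2
      exact Prod.ext h1 (by simpa using h2)

theorem summable_opNorm_backwardTerm
    (hs : Summable fun q : ℤ × ℤ => opNorm (limitTerm C S W N h q.1 q.2)) :
    Summable fun q : ℕ × ℕ+ => opNorm (backwardTerm C S N h q.1 q.2) := by
  simp_rw [backwardTerm_eq W N]
  exact hs.comp_injective (i := fun q : ℕ × ℕ+ => ((q.1 : ℤ), (q.1 : ℤ) + h + -((q.2 : ℕ) : ℤ)))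
    fun a b hab => by
      simp only [Prod.mk.injEq, Nat.cast_inj] at hab
      obtain ⟨h1, h2⟩ := hab
      rw [h1] at h2
      exact Prod.ext h1 (by simpa using h2)

theorem limitMat_apply_eq_tsum (hC_neg : ∀ j < 0, C j = 0)
    (hs : Summable fun q : ℤ × ℤ => opNorm (limitTerm C S W N h q.1 q.2)) (a b : Fin m) :
    limitMat C S W N h a b = ∑' q : ℤ × ℤ, limitTerm C S W N h q.1 q.2 a b := by
  have hab : Summable fun q : ℤ × ℤ => limitTerm C S W N h q.1 q.2 a b :=
    Summable.of_norm_bounded hs fun q => abs_entry_le_opNorm _ _ _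
  have hd := summable_opNorm_diagTerm hs
  have hf := summable_opNorm_forwardTerm hs
  have hb := summable_opNorm_backwardTerm hs
  have hf' : Summable fun q : ℕ × ℕ+ => forwardTerm C S N h q.1 q.2 a b :=
    Summable.of_norm_bounded hf fun q => abs_entry_le_opNorm _ _ _
  have hb' : Summable fun q : ℕ × ℕ+ => backwardTerm C S N h q.1 q.2 a b :=
    Summable.of_norm_bounded hb fun q => abs_entry_le_opNorm _ _ _
  have hd' : ∀ a b, Summable fun j : ℕ => diagTerm C W h j a b := fun a b =>
    Summable.of_norm_bounded hd fun q => abs_entry_le_opNorm _ _ _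
  have hF : ∑' q : ℤ × ℤ, limitTerm C S W N h q.1 q.2 a b
      = ∑' i : ℕ, ∑' j : ℤ, limitTerm C S W N h i j a b := by
    rw [hab.tsum_prod]
    refine (tsum_nat_eq_tsum_int (f := fun i => ∑' j : ℤ, limitTerm C S W N h i j a b)
      fun i hi => ?_).symm
    simp [limitTerm, hC_neg i hi]
  -- After the translation `j ↦ i + h + j`, splitting `ℤ` into zero, positive and negative integers
  -- yields the three series.
  have key : ∀ i : ℕ, ∑' j : ℤ, limitTerm C S W N h i j a b = diagTerm C W h i a b
      + ∑' r : ℕ+, forwardTerm C S N h i r a b + ∑' r : ℕ+, backwardTerm C S N h i r a b := by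
    intro i
    have e := (Equiv.addLeft ((i : ℤ) + h)).tsum_eq fun j => limitTerm C S W N h i j a b
    have hs' : Summable fun j : ℤ => limitTerm C S W N h i (Equiv.addLeft ((i : ℤ) + h) j) a b :=
      (hab.prod_factor (i : ℤ)).comp_injective (Equiv.injective _)
    rw [← e, tsum_int_eq_zero_add_tsum_pnat hs']
    simp only [Equiv.coe_addLeft, add_zero, diagTerm_eq (S := S) W N, forwardTerm_eq W N,
      backwardTerm_eq W N]
  have hfs := hf'.prod
  have hbs := hb'.prod
  rw [hF, tsum_congr key, Summable.tsum_add ((hd' a b).add hfs) hbs,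
    Summable.tsum_add (hd' a b) hfs, limitMat, Matrix.add_apply, Matrix.add_apply,
    tsum_matrix_apply hd', tsum_tsum_matrix_apply hf, tsum_tsum_matrix_apply hb]

theorem limitTerm_apply (i j : ℤ) (a b : Fin m) :
    limitTerm C S W N h i j a b = ∑ p : Fin m × Fin m, C i a p.1 * C j b p.2
      * signedLaggedMat S W N (j - i - h) p.1 p.2 := by
  rw [Fintype.sum_prod_type_right]
  simp only [limitTerm, Matrix.mul_apply, Matrix.transpose_apply, Finset.sum_mul]
  exact Finset.sum_congr rfl fun _ _ => Finset.sum_congr rfl fun _ _ => by ring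

end

theorem summable_abs_coeff (hC : Summable fun j : ℤ => opNorm (C j)) (a : Fin m) :
    Summable fun p : ℤ × Fin m => |C p.1 a p.2| := by
  have h1 : Summable fun p : ℤ × Fin m => opNorm (C p.1) * (1 : ℝ) :=
    hC.mul_of_nonneg (Summable.of_finite (f := fun _ : Fin m => (1 : ℝ)))
      (fun _ => opNorm_nonneg _) fun _ => zero_le_one
  exact Summable.of_nonneg_of_le (fun _ => abs_nonneg _)
    (fun p => by simpa using abs_entry_le_opNorm (C p.1) a p.2) h1

theorem summable_abs_coeff_mul (hC : Summable fun j : ℤ => opNorm (C j)) (a b : Fin m) :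
    Summable fun q : (ℤ × Fin m) × (ℤ × Fin m) => |C q.1.1 a q.1.2 * C q.2.1 b q.2.2| := by
  simp_rw [abs_mul]
  exact (summable_abs_coeff hC a).mul_of_nonneg (summable_abs_coeff hC b)
    (fun _ => abs_nonneg _) fun _ => abs_nonneg _

variable {Ω' : Type*} [MeasurableSpace Ω'] {μ' : Measure Ω'} [IsProbabilityMeasure μ']
  {V : Matrix (Fin m × Fin m) (Fin m × Fin m) ℝ}
  {W : Ω' → Matrix (Fin m) (Fin m) ℝ} {N : ℕ+ → Ω' → Matrix (Fin m) (Fin m) ℝ}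

/-- Each term is dominated by `‖C_i‖ ‖C_j‖` times the sum of the absolute entries of a lagged
matrix, whose expectation is bounded uniformly in the lag. -/
theorem IsLimitNoise.ae_summable_limitTerm (hWN : IsLimitNoise V W N μ')
    (hV : ∀ a b a' b', V (b, a) (b', a') = V (a, b) (a', b'))
    (hC : Summable fun j : ℤ => opNorm (C j)) (h : ℕ) :
    ∀ᵐ ω ∂μ', Summable fun q : ℤ × ℤ =>
      opNorm (limitTerm C S (W ω) (fun r => N r ω) h q.1 q.2) := by
  obtain ⟨c, hc⟩ := hWN.exists_integral_abs_laggedMat_le (S := S) hV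
  have hw : Summable fun q : ℤ × ℤ => |opNorm (C q.1) * opNorm (C q.2)| := by
    have h0 : (0 : ℤ → ℝ) ≤ fun j => opNorm (C j) := fun j => opNorm_nonneg (C j)
    refine (Summable.mul_of_nonneg hC hC h0 h0).congr fun q => ?_
    exact (abs_of_nonneg (mul_nonneg (opNorm_nonneg _) (opNorm_nonneg _))).symm
  let f : ℕ → Ω' → ℝ := fun r ω => ∑ p : Fin m × Fin m,
    |laggedMat S (W ω) (fun r => N r ω) r p.1 p.2|
  have hint : ∀ r a b, Integrable (fun ω => |laggedMat S (W ω) (fun r => N r ω) r a b|) μ' :=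
    fun r a b => (hWN.hasGaussianLaw_laggedMat r a b).integrable.abs
  have hf : ∀ r, Integrable (f r) μ' := fun r => integrable_finsetSum _ fun p _ => hint _ _ _
  have hf0 : ∀ r ω, |f r ω| = f r ω := fun r ω =>
    abs_of_nonneg (Finset.sum_nonneg fun _ _ => abs_nonneg _)
  have hfc : ∀ r, ∫ ω, |f r ω| ∂μ' ≤ ∑ p : Fin m × Fin m, c := by
    intro r
    simp_rw [hf0]
    refine (integral_finsetSum _ fun p _ => hint r p.1 p.2).trans_le ?_
    exact Finset.sum_le_sum fun p _ => hc _ _ _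
  have h1 := ae_summable_abs_mul hw (f := fun q => f (q.2 - q.1 - h).natAbs) (fun q => hf _)
    fun q => hfc _
  filter_upwards [h1] with ω hω
  refine Summable.of_nonneg_of_le (fun _ => opNorm_nonneg _) (fun q => ?_) hω
  refine (opNorm_mul_mul_transpose_le _ _ _).trans (le_trans ?_ (le_abs_self _))
  refine mul_le_mul_of_nonneg_left ?_ (mul_nonneg (opNorm_nonneg _) (opNorm_nonneg _))
  refine le_trans ?_ (opNorm_le_sum_abs _)
  rw [signedLaggedMat]
  split_ifs
  · exact le_rfl
  · rw [opNorm_transpose]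

/-- The lag is written as `-i - (h - j)` so that it is literally the difference of the offsets in
`IsMovingAverage.ae_hasSum_sum_centered`. -/
theorem IsLimitNoise.ae_limitMat_apply_eq_tsum (hWN : IsLimitNoise V W N μ')
    (hV : ∀ a b a' b', V (b, a) (b', a') = V (a, b) (a', b')) (hC_neg : ∀ j < 0, C j = 0)
    (hC : Summable fun j : ℤ => opNorm (C j)) (h : ℕ) (a b : Fin m) :
    ∀ᵐ ω ∂μ', HasSum (fun q : (ℤ × Fin m) × (ℤ × Fin m) => C q.1.1 a q.1.2 * C q.2.1 b q.2.2
        * laggedMat S (W ω) (fun r => N r ω) (-q.1.1 - (h - q.2.1)).natAbs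
          (orderedCoords (-q.1.1 - (h - q.2.1)) q.1.2 q.2.2).1
          (orderedCoords (-q.1.1 - (h - q.2.1)) q.1.2 q.2.2).2)
      (limitMat C S (W ω) (fun r => N r ω) h a b) := by
  obtain ⟨c, hc⟩ := hWN.exists_integral_abs_laggedMat_le (S := S) hV
  have h1 := ae_summable_abs_mul (summable_abs_coeff_mul hC a b) (μ := μ')
    (f := fun q ω => laggedMat S (W ω) (fun r => N r ω) (-q.1.1 - (h - q.2.1)).natAbs
          (orderedCoords (-q.1.1 - (h - q.2.1)) q.1.2 q.2.2).1
          (orderedCoords (-q.1.1 - (h - q.2.1)) q.1.2 q.2.2).2)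
    (fun q => (hWN.hasGaussianLaw_laggedMat _ _ _).integrable) fun q => hc _ _ _
  filter_upwards [h1, hWN.ae_summable_limitTerm hV hC h (S := S)] with ω hω hω'
  have hsum := hω.of_abs
  rw [limitMat_apply_eq_tsum hC_neg hω']
  have e : ∑' q : ℤ × ℤ, limitTerm C S (W ω) (fun r => N r ω) h q.1 q.2 a b
      = ∑' q : (ℤ × Fin m) × (ℤ × Fin m), C q.1.1 a q.1.2 * C q.2.1 b q.2.2
        * laggedMat S (W ω) (fun r => N r ω) (-q.1.1 - (h - q.2.1)).natAbs
          (orderedCoords (-q.1.1 - (h - q.2.1)) q.1.2 q.2.2).1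
          (orderedCoords (-q.1.1 - (h - q.2.1)) q.1.2 q.2.2).2 := by
    -- Regrouping times and coordinates exposes the finite coordinate sum inside each `limitTerm`.
    have h2 := (hsum.comp_injective (Equiv.prodProdProdComm ℤ ℤ (Fin m) (Fin m)).injective).tsum_prod
    refine Eq.symm (((Equiv.prodProdProdComm ℤ ℤ (Fin m) (Fin m)).tsum_eq _).symm.trans
      (h2.trans ?_))
    refine Eq.symm ?_
    refine tsum_congr fun q => ?_
    rw [tsum_fintype, limitTerm_apply]
    refine Finset.sum_congr rfl fun p _ => ?_
    rw [signedLaggedMat_apply]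
    simp only [Function.comp_def, Equiv.prodProdProdComm_apply]
    rw [show q.2 - q.1 - (h : ℤ) = -q.1 - (h - q.2) by ring]
  rw [e]
  exact hsum.hasSum

end LimitSeries

/-! ### The moving average: expansion in noise products and moment bounds. -/

section

theorem hasSum_mul_of_summable_abs {ι κ : Type*} {f : ι → ℝ} {g : κ → ℝ}
    (hf : Summable fun i => |f i|) (hg : Summable fun j => |g j|) :
    HasSum (fun q : ι × κ => f q.1 * g q.2) ((∑' i, f i) * ∑' j, g j) := by
  have hf' : Summable fun i => ‖f i‖ := hf
  have hg' : Summable fun j => ‖g j‖ := hg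
  rw [tsum_mul_tsum_of_summable_norm hf' hg']
  exact (summable_mul_of_summable_norm hf' hg').hasSum

/-- `Y` is the causal moving average of the noise `ξ` with absolutely summable coefficients `C`. -/
structure IsMovingAverage {Ω : Type*} [MeasurableSpace Ω] {m : ℕ}
    (C : ℤ → Matrix (Fin m) (Fin m) ℝ) (ξ Y : ℤ → Ω → EuclideanSpace ℝ (Fin m)) (μ : Measure Ω) :
    Prop where
  noise : IsNoise ξ μ
  causal : ∀ j < 0, C j = 0
  summable : Summable fun j : ℕ => opNorm (C j)
  ae_eq : ∀ k : ℤ, Y k =ᵐ[μ] fun ω => ∑' j : ℕ, applyMat (C j) (ξ (k - (j : ℤ)) ω)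

variable {Ω : Type*} [MeasurableSpace Ω] {μ : Measure Ω} [IsProbabilityMeasure μ] {m : ℕ}
  {C : ℤ → Matrix (Fin m) (Fin m) ℝ} {ξ Y : ℤ → Ω → EuclideanSpace ℝ (Fin m)}

namespace IsNoise

theorem integrable_norm (hξ : IsNoise ξ μ) (k : ℤ) : Integrable (fun ω => ‖ξ k ω‖) μ :=
  ((hξ.memLp k).integrable (by norm_num)).norm

theorem integral_norm (hξ : IsNoise ξ μ) (k : ℤ) : ∫ ω, ‖ξ k ω‖ ∂μ = ∫ ω, ‖ξ 1 ω‖ ∂μ :=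
  ((hξ.ident k).comp (u := fun x => ‖x‖) (by fun_prop)).integral_eq

theorem memLp_two_coord (hξ : IsNoise ξ μ) (k : ℤ) (a : Fin m) :
    MemLp (fun ω => ξ k ω a) 2 μ :=
  (hξ.memLp_coord k a).mono_exponent (by norm_num)

theorem integrable_norm_sq (hξ : IsNoise ξ μ) (k : ℤ) : Integrable (fun ω => ‖ξ k ω‖ ^ 2) μ :=
  ((hξ.memLp k).mono_exponent (by norm_num : (2 : ENNReal) ≤ 4)).integrable_norm_pow (by norm_num)

theorem integral_coord_sq_le (hξ : IsNoise ξ μ) (k : ℤ) (a : Fin m) :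
    ∫ ω, ξ k ω a ^ 2 ∂μ ≤ ∫ ω, ‖ξ 1 ω‖ ^ 2 ∂μ := by
  have e : ∫ ω, ‖ξ k ω‖ ^ 2 ∂μ = ∫ ω, ‖ξ 1 ω‖ ^ 2 ∂μ :=
    ((hξ.ident k).comp (u := fun x => ‖x‖ ^ 2) (by fun_prop)).integral_eq
  rw [← e]
  refine integral_mono (hξ.memLp_two_coord k a).integrable_sq (hξ.integrable_norm_sq k) fun ω => ?_
  exact sq_le_sq.2 (by simpa using PiLp.norm_apply_le (ξ k ω) a)

theorem memLp_two_sum (hξ : IsNoise ξ μ) (I : Finset ℤ) (i : ℤ) (a : Fin m) :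
    MemLp (fun ω => ∑ k ∈ I, ξ (k - i) ω a) 2 μ :=
  memLp_finsetSum I fun _ _ => hξ.memLp_two_coord _ _

theorem integral_sum_coord_sq_le (hξ : IsNoise ξ μ) (I : Finset ℤ) (i : ℤ) (a : Fin m) :
    ∫ ω, (∑ k ∈ I, ξ (k - i) ω a) ^ 2 ∂μ ≤ I.card * ∫ ω, ‖ξ 1 ω‖ ^ 2 ∂μ := by
  rw [integral_sum_sq_of_orthogonal I (fun k _ => hξ.memLp_two_coord _ _)
    (fun k _ l _ hkl => hξ.integral_coord_mul (by omega) _ _)]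
  calc _ ≤ ∑ k ∈ I, ∫ ω, ‖ξ 1 ω‖ ^ 2 ∂μ :=
        Finset.sum_le_sum fun k _ => hξ.integral_coord_sq_le _ _
    _ = _ := by simp

theorem integrable_sum_mul_sum (hξ : IsNoise ξ μ) (I I' : Finset ℤ) (i j : ℤ) (a b : Fin m) :
    Integrable (fun ω => (∑ k ∈ I, ξ (k - i) ω a) * ∑ k ∈ I', ξ (k - j) ω b) μ :=
  (hξ.memLp_two_sum I i a).integrable_mul (hξ.memLp_two_sum I' j b)

/-- From `|xy| ≤ (x² + y²)/2` and orthogonality of the noise; the bound does not depend on the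
shifts `i`, `j`, so it passes to the moving average. -/
theorem integral_abs_sum_mul_sum_le (hξ : IsNoise ξ μ) {I I' : Finset ℤ} {n : ℕ} (hI : I.card ≤ n)
    (hI' : I'.card ≤ n) (i j : ℤ) (a b : Fin m) :
    ∫ ω, |(∑ k ∈ I, ξ (k - i) ω a) * ∑ k ∈ I', ξ (k - j) ω b| ∂μ
      ≤ n * ∫ ω, ‖ξ 1 ω‖ ^ 2 ∂μ := by
  have h0 : 0 ≤ ∫ ω, ‖ξ 1 ω‖ ^ 2 ∂μ := integral_nonneg fun ω => by positivity
  have hX := (hξ.memLp_two_sum I i a).integrable_sq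
  have hY := (hξ.memLp_two_sum I' j b).integrable_sq
  calc ∫ ω, |(∑ k ∈ I, ξ (k - i) ω a) * ∑ k ∈ I', ξ (k - j) ω b| ∂μ
      ≤ ∫ ω, (1 / 2 * (∑ k ∈ I, ξ (k - i) ω a) ^ 2
          + 1 / 2 * (∑ k ∈ I', ξ (k - j) ω b) ^ 2) ∂μ := by
        refine integral_mono (hξ.integrable_sum_mul_sum I I' i j a b).abs
          ((hX.const_mul _).add (hY.const_mul _)) fun ω => ?_
        change |_ * _| ≤ _
        rw [abs_mul, ← sq_abs (∑ k ∈ I, ξ (k - i) ω a), ← sq_abs (∑ k ∈ I', ξ (k - j) ω b)]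
        nlinarith [sq_nonneg (|∑ k ∈ I, ξ (k - i) ω a| - |∑ k ∈ I', ξ (k - j) ω b|)]
    _ = 1 / 2 * ∫ ω, (∑ k ∈ I, ξ (k - i) ω a) ^ 2 ∂μ
          + 1 / 2 * ∫ ω, (∑ k ∈ I', ξ (k - j) ω b) ^ 2 ∂μ := by
        rw [integral_add (hX.const_mul _) (hY.const_mul _), integral_const_mul, integral_const_mul]
    _ ≤ 1 / 2 * (n * ∫ ω, ‖ξ 1 ω‖ ^ 2 ∂μ) + 1 / 2 * (n * ∫ ω, ‖ξ 1 ω‖ ^ 2 ∂μ) := by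
        have h1 : (I.card : ℝ) ≤ n := by exact_mod_cast hI
        have h2 : (I'.card : ℝ) ≤ n := by exact_mod_cast hI'
        have h3 := (hξ.integral_sum_coord_sq_le I i a).trans (mul_le_mul_of_nonneg_right h1 h0)
        have h4 := (hξ.integral_sum_coord_sq_le I' j b).trans (mul_le_mul_of_nonneg_right h2 h0)
        linarith
    _ = _ := by ring

end IsNoise

namespace IsMovingAverage

theorem summable_int (hY : IsMovingAverage C ξ Y μ) : Summable fun j : ℤ => opNorm (C j) :=
  summable_opNorm_int hY.causal hY.summable

theorem ae_summable_norm (hY : IsMovingAverage C ξ Y μ) (k : ℤ) :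
    ∀ᵐ ω ∂μ, Summable fun j : ℕ => ‖applyMat (C j) (ξ (k - (j : ℤ)) ω)‖ := by
  have hw : Summable fun j : ℕ => |opNorm (C j)| :=
    hY.summable.congr fun j => (abs_of_nonneg (opNorm_nonneg _)).symm
  have h1 := ae_summable_abs_mul hw (f := fun (j : ℕ) ω => ‖ξ (k - (j : ℤ)) ω‖)
    (fun j => hY.noise.integrable_norm _) (c := ∫ ω, ‖ξ 1 ω‖ ∂μ) fun j => by
      simp_rw [abs_norm]
      exact (hY.noise.integral_norm _).le
  filter_upwards [h1] with ω hω
  exact Summable.of_nonneg_of_le (fun _ => norm_nonneg _)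
    (fun j => (norm_applyMat_le _ _).trans (le_abs_self _)) hω

theorem ae_summable_coord (hY : IsMovingAverage C ξ Y μ) (k : ℤ) (a : Fin m) :
    ∀ᵐ ω ∂μ, Summable fun p : ℤ × Fin m => |C p.1 a p.2 * ξ (k - p.1) ω p.2| := by
  refine ae_summable_abs_mul (summable_abs_coeff hY.summable_int a)
    (f := fun p ω => ξ (k - p.1) ω p.2)
    (fun p => (hY.noise.memLp_two_coord _ _).integrable one_le_two)
    (c := ∫ ω, ‖ξ 1 ω‖ ∂μ) fun p => ?_
  rw [← hY.noise.integral_norm (k - p.1)]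
  refine integral_mono ((hY.noise.memLp_two_coord _ _).integrable one_le_two).abs
    (hY.noise.integrable_norm _) fun ω => PiLp.norm_apply_le (ξ (k - p.1) ω) p.2

theorem ae_apply_eq_tsum (hY : IsMovingAverage C ξ Y μ) (k : ℤ) (a : Fin m) :
    ∀ᵐ ω ∂μ, Y k ω a = ∑' p : ℤ × Fin m, C p.1 a p.2 * ξ (k - p.1) ω p.2 := by
  filter_upwards [hY.ae_eq k, hY.ae_summable_norm k, hY.ae_summable_coord k a] with ω h1 h2 h3
  have e : (∑' j : ℕ, applyMat (C j) (ξ (k - (j : ℤ)) ω)) a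
      = ∑' j : ℕ, applyMat (C j) (ξ (k - (j : ℤ)) ω) a :=
    (EuclideanSpace.proj (𝕜 := ℝ) a).map_tsum h2.of_norm
  rw [h1, e, h3.of_abs.tsum_prod, ← tsum_nat_eq_tsum_int
    (f := fun i => ∑' c : Fin m, C i a c * ξ (k - i) ω c)]
  · refine tsum_congr fun j => ?_
    rw [applyMat_apply, tsum_fintype]
  · intro i hi
    simp [hY.causal i hi]

/-- A product of two absolutely convergent series. Countability of the indices puts all of them
under one null set. -/
theorem ae_hasSum_mul (hY : IsMovingAverage C ξ Y μ) :
    ∀ᵐ ω ∂μ, ∀ (k l : ℤ) (a b : Fin m),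
      HasSum (fun q : (ℤ × Fin m) × (ℤ × Fin m) => C q.1.1 a q.1.2 * C q.2.1 b q.2.2
        * (ξ (k - q.1.1) ω q.1.2 * ξ (l - q.2.1) ω q.2.2)) (Y k ω a * Y l ω b) := by
  have h1 := ae_all_iff.2 fun k => ae_all_iff.2 fun a => hY.ae_summable_coord k a
  have h2 := ae_all_iff.2 fun k => ae_all_iff.2 fun a => hY.ae_apply_eq_tsum k a
  filter_upwards [h1, h2] with ω hs he k l a b
  rw [he k a, he l b]
  have h3 := hasSum_mul_of_summable_abs (hs k a) (hs l b)
  convert h3 using 2 with q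
  ring

theorem ae_hasSum_sum_mul_sum (hY : IsMovingAverage C ξ Y μ) :
    ∀ᵐ ω ∂μ, ∀ (I I' : Finset ℤ) (a b : Fin m),
      HasSum (fun q : (ℤ × Fin m) × (ℤ × Fin m) => C q.1.1 a q.1.2 * C q.2.1 b q.2.2
        * ((∑ k ∈ I, ξ (k - q.1.1) ω q.1.2) * ∑ l ∈ I', ξ (l - q.2.1) ω q.2.2))
        ((∑ k ∈ I, Y k ω a) * ∑ l ∈ I', Y l ω b) := by
  filter_upwards [hY.ae_hasSum_mul] with ω hω I I' a b
  simp_rw [Finset.sum_mul_sum, Finset.mul_sum]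
  exact hasSum_sum fun k _ => hasSum_sum fun l _ => hω k l a b

theorem integrable_sum_mul_sum (hY : IsMovingAverage C ξ Y μ) (I I' : Finset ℤ) (a b : Fin m) :
    Integrable (fun ω => (∑ k ∈ I, Y k ω a) * ∑ l ∈ I', Y l ω b) μ := by
  have h1 := integrable_tsum_mul (summable_abs_coeff_mul hY.summable_int a b)
    (f := fun q ω => (∑ k ∈ I, ξ (k - q.1.1) ω q.1.2) * ∑ l ∈ I', ξ (l - q.2.1) ω q.2.2)
    (fun q => hY.noise.integrable_sum_mul_sum I I' _ _ _ _) fun q =>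
      hY.noise.integral_abs_sum_mul_sum_le (le_max_left I.card I'.card) (le_max_right _ _) _ _ _ _
  refine h1.congr ?_
  filter_upwards [hY.ae_hasSum_sum_mul_sum] with ω hω
  exact (hω I I' a b).tsum_eq

/-- A bound on the expected products of partial sums, linear in their length. -/
theorem integral_abs_sum_mul_sum_le (hY : IsMovingAverage C ξ Y μ) {I I' : Finset ℤ} {n : ℕ}
    (hI : I.card ≤ n) (hI' : I'.card ≤ n) (a b : Fin m) :
    ∫ ω, |(∑ k ∈ I, Y k ω a) * ∑ l ∈ I', Y l ω b| ∂μ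
      ≤ (∑' q : (ℤ × Fin m) × (ℤ × Fin m), |C q.1.1 a q.1.2 * C q.2.1 b q.2.2|)
        * (n * ∫ ω, ‖ξ 1 ω‖ ^ 2 ∂μ) := by
  have h1 := integral_abs_tsum_mul_le (summable_abs_coeff_mul hY.summable_int a b)
    (f := fun q ω => (∑ k ∈ I, ξ (k - q.1.1) ω q.1.2) * ∑ l ∈ I', ξ (l - q.2.1) ω q.2.2)
    (fun q => hY.noise.integrable_sum_mul_sum I I' _ _ _ _) fun q =>
      hY.noise.integral_abs_sum_mul_sum_le hI hI' _ _ _ _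
  refine (integral_congr_ae ?_).trans_le h1
  filter_upwards [hY.ae_hasSum_sum_mul_sum] with ω hω
  rw [(hω I I' a b).tsum_eq]

theorem aemeasurable (hY : IsMovingAverage C ξ Y μ) (k : ℤ) : AEMeasurable (Y k) μ := by
  refine AEMeasurable.congr ?_ (hY.ae_eq k).symm
  refine AEMeasurable.tsum fun j => ?_
  exact (Matrix.toEuclideanCLM (𝕜 := ℝ) (C j)).continuous.measurable.comp_aemeasurable
    (hY.noise.aemeasurable _)

theorem aemeasurable_coord (hY : IsMovingAverage C ξ Y μ) (k : ℤ) (a : Fin m) :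
    AEMeasurable (fun ω => Y k ω a) μ :=
  (EuclideanSpace.proj (𝕜 := ℝ) a).continuous.measurable.comp_aemeasurable (hY.aemeasurable k)

theorem memLp_coord (hY : IsMovingAverage C ξ Y μ) (k : ℤ) (a : Fin m) :
    MemLp (fun ω => Y k ω a) 2 μ := by
  refine (memLp_two_iff_integrable_sq (hY.aemeasurable_coord k a).aestronglyMeasurable).2 ?_
  simpa [sq] using hY.integrable_sum_mul_sum {k} {k} a a

theorem memLp (hY : IsMovingAverage C ξ Y μ) (k : ℤ) : MemLp (Y k) 2 μ :=
  MemLp.of_eval_piLp fun a => hY.memLp_coord k a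

theorem autocov_apply (h : ℤ) (a b : Fin m) :
    autocov μ Y h a b = ∫ ω, Y 0 ω a * Y h ω b ∂μ := by
  simp [autocov, expMat, outerProd, Matrix.vecMulVec_apply]

/-- Stationarity leaves `k` free, so the expansion can be subtracted termwise from that of `Y_k
Y_{k+h}ᵀ`; this centres each noise product. -/
theorem hasSum_autocov (hY : IsMovingAverage C ξ Y μ) (k h : ℤ) (a b : Fin m) :
    HasSum (fun q : (ℤ × Fin m) × (ℤ × Fin m) => C q.1.1 a q.1.2 * C q.2.1 b q.2.2
        * ∫ ω, ξ (k - q.1.1) ω q.1.2 * ξ (k + h - q.2.1) ω q.2.2 ∂μ) (autocov μ Y h a b) := by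
  have e : ∫ ω, Y 0 ω a * Y h ω b ∂μ = ∫ ω, ∑' q : (ℤ × Fin m) × (ℤ × Fin m),
      C q.1.1 a q.1.2 * C q.2.1 b q.2.2
        * ((∑ k ∈ {0}, ξ (k - q.1.1) ω q.1.2) * ∑ l ∈ {h}, ξ (l - q.2.1) ω q.2.2) ∂μ := by
    refine integral_congr_ae ?_
    filter_upwards [hY.ae_hasSum_sum_mul_sum] with ω hω
    rw [(hω {0} {h} a b).tsum_eq]
    simp
  have h1 := integral_tsum_mul (summable_abs_coeff_mul hY.summable_int a b)
    (f := fun q ω => (∑ k ∈ {0}, ξ (k - q.1.1) ω q.1.2) * ∑ l ∈ {h}, ξ (l - q.2.1) ω q.2.2)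
    (fun q => hY.noise.integrable_sum_mul_sum {0} {h} _ _ _ _) fun q =>
      hY.noise.integral_abs_sum_mul_sum_le (n := 1) (by simp) (by simp) _ _ _ _
  rw [autocov_apply, e]
  convert h1 using 2 with q
  congr 1
  simp only [Finset.sum_singleton]
  rw [← hY.noise.integral_coord_mul_shift (0 - q.1.1) (h - q.2.1) k,
    show 0 - q.1.1 + k = k - q.1.1 by ring, show h - q.2.1 + k = k + h - q.2.1 by ring]

theorem ae_hasSum_sum_centered (hY : IsMovingAverage C ξ Y μ) (I : Finset ℤ) (h : ℕ)
    (a b : Fin m) :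
    ∀ᵐ ω ∂μ, HasSum (fun q : (ℤ × Fin m) × (ℤ × Fin m) => C q.1.1 a q.1.2 * C q.2.1 b q.2.2
        * ∑ k ∈ I, centeredProd ξ μ (k + -q.1.1) q.1.2 (k + (h - q.2.1)) q.2.2 ω)
      (∑ k ∈ I, (Y k ω a * Y (k + h) ω b - autocov μ Y h a b)) := by
  filter_upwards [hY.ae_hasSum_mul] with ω hω
  simp_rw [Finset.mul_sum]
  refine hasSum_sum fun k _ => ?_
  simp only [centeredProd, mul_sub, ← sub_eq_add_neg, ← add_sub_assoc]
  exact (hω k (k + h) a b).sub (hY.hasSum_autocov k h a b)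

end IsMovingAverage

end

/-! ### Negligibility of centring at the sample mean. -/

section

section Deterministic

variable {m : ℕ}

theorem sum_nat_Icc_eq_sum_int_Icc {E : Type*} [AddCommMonoid E] (f : ℤ → E) {n h : ℕ}
    (hn : h ≤ n) :
    ∑ k ∈ Finset.Icc 1 (n - h), f (k : ℤ) = ∑ k ∈ Finset.Icc (1 : ℤ) (n - h), f k := by
  have e : (Finset.Icc 1 (n - h)).image (Nat.cast : ℕ → ℤ) = Finset.Icc (1 : ℤ) (n - h) := by
    ext k
    simp only [Finset.mem_image, Finset.mem_Icc]
    constructor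
    · rintro ⟨i, hi, rfl⟩
      omega
    · exact fun hk => ⟨k.toNat, by omega, by omega⟩
  rw [← e, Finset.sum_image fun _ _ _ _ hab => Nat.cast_injective hab]

theorem sampleMean_apply (y : ℤ → EuclideanSpace ℝ (Fin m)) (n : ℕ) (a : Fin m) :
    sampleMean y n a = (∑ k ∈ Finset.Icc (1 : ℤ) n, y k a) / n := by
  have := sum_nat_Icc_eq_sum_int_Icc (fun k => y k a) (Nat.zero_le n)
  simp only [Nat.cast_zero, sub_zero, Nat.sub_zero] at this
  rw [sampleMean, ← this]
  simp
  ring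

theorem sampleAutocov_apply (y : ℤ → EuclideanSpace ℝ (Fin m)) (n h : ℕ) (a b : Fin m) :
    sampleAutocov y n h a b = (1 / (n : ℝ)) * ∑ k ∈ Finset.Icc 1 (n - h),
      (y (k : ℤ) a - sampleMean y n a) * (y ((k : ℤ) + (h : ℤ)) b - sampleMean y n b) := by
  simp [sampleAutocov, outerProd, Matrix.sum_apply, Matrix.vecMulVec_apply]

/-- The effect of centring at the sample mean. -/
theorem abs_sqrt_mul_sampleAutocov_sub_le (y : ℤ → EuclideanSpace ℝ (Fin m)) {n h : ℕ}
    (hn : h ≤ n) (hn0 : 0 < n) (a b : Fin m) (G : ℝ) :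
    |√(n : ℝ) * (sampleAutocov y n h a b - G)
        - (√(n : ℝ))⁻¹ * ∑ k ∈ Finset.Icc (1 : ℤ) (n - h), (y k a * y (k + h) b - G)|
      ≤ (√(n : ℝ))⁻¹ * (
        |(∑ k ∈ Finset.Icc (1 : ℤ) (n - h), y k a) * ∑ k ∈ Finset.Icc (1 : ℤ) n, y k b| / n
        + |(∑ k ∈ Finset.Icc (1 : ℤ) n, y k a)
            * ∑ k ∈ (Finset.Icc (1 : ℤ) (n - h)).map (addRightEmbedding (h : ℤ)), y k b| / n
        + |(∑ k ∈ Finset.Icc (1 : ℤ) n, y k a) * ∑ k ∈ Finset.Icc (1 : ℤ) n, y k b| / n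
        + h * |G|) := by
  have hn' : (0 : ℝ) < n := by exact_mod_cast hn0
  have hh : (h : ℝ) ≤ n := by exact_mod_cast hn
  have hcard : ((Finset.Icc (1 : ℤ) (n - h)).card : ℝ) = n - h := by
    rw [Int.card_Icc, show ((n : ℤ) - h + 1 - 1).toNat = n - h by omega, Nat.cast_sub hn]
  rw [sampleAutocov_apply, sum_nat_Icc_eq_sum_int_Icc
    (fun k => (y k a - sampleMean y n a) * (y (k + h) b - sampleMean y n b)) hn,
    sampleMean_apply, sampleMean_apply, Finset.sum_map]
  simp only [addRightEmbedding_apply]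
  set I := Finset.Icc (1 : ℤ) (n - h)
  set Ta := ∑ k ∈ Finset.Icc (1 : ℤ) n, y k a
  set Tb := ∑ k ∈ Finset.Icc (1 : ℤ) n, y k b
  have e1 : ∑ k ∈ I, (y k a - Ta / n) * (y (k + h) b - Tb / n) = ∑ k ∈ I, y k a * y (k + h) b
      - (∑ k ∈ I, y k a) * Tb / n - Ta * (∑ k ∈ I, y (k + h) b) / n
      + (n - h) * (Ta * Tb) / n ^ 2 := by
    simp only [sub_mul, mul_sub, Finset.sum_sub_distrib, ← Finset.sum_mul, ← Finset.mul_sum,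
      Finset.sum_const, nsmul_eq_mul, hcard]
    field_simp
    ring
  have e2 : ∑ k ∈ I, (y k a * y (k + h) b - G) = ∑ k ∈ I, y k a * y (k + h) b - (n - h) * G := by
    rw [Finset.sum_sub_distrib, Finset.sum_const, nsmul_eq_mul, hcard]
  rw [e1, e2]
  set A := ∑ k ∈ I, y k a
  set B := ∑ k ∈ I, y (k + h) b
  set P := ∑ k ∈ I, y k a * y (k + h) b
  have hs : √(n : ℝ) = (√(n : ℝ))⁻¹ * n := by
    rw [inv_mul_eq_div, Real.div_sqrt]
  have e3 : √(n : ℝ) * (1 / n * (P - A * Tb / n - Ta * B / n + (n - h) * (Ta * Tb) / n ^ 2) - G)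
      - (√(n : ℝ))⁻¹ * (P - (n - h) * G)
      = (√(n : ℝ))⁻¹ * (-(A * Tb / n) - Ta * B / n + (n - h) / n * (Ta * Tb / n) - h * G) := by
    nth_rw 1 [hs]
    field_simp
    ring
  rw [e3, abs_mul, abs_of_nonneg (inv_nonneg.2 (Real.sqrt_nonneg _))]
  refine mul_le_mul_of_nonneg_left ?_ (inv_nonneg.2 (Real.sqrt_nonneg _))
  have h4 : |(n - h) / n * (Ta * Tb / n)| ≤ |Ta * Tb| / n := by
    rw [abs_mul, abs_div (Ta * Tb), Nat.abs_cast]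
    refine mul_le_of_le_one_left (by positivity) ?_
    rw [abs_of_nonneg (div_nonneg (sub_nonneg.2 hh) hn'.le), div_le_one hn']
    linarith [(Nat.cast_nonneg h : (0 : ℝ) ≤ h)]
  have h5 : |(h : ℝ) * G| = h * |G| := by rw [abs_mul, Nat.abs_cast]
  have h6 : |A * Tb / n| = |A * Tb| / n := by rw [abs_div, Nat.abs_cast]
  have h7 : |Ta * B / n| = |Ta * B| / n := by rw [abs_div, Nat.abs_cast]
  rw [← h5, ← h6, ← h7]
  refine (abs_sub _ _).trans ?_
  refine add_le_add ((abs_add_le _ _).trans (add_le_add ((abs_sub _ _).trans ?_) h4)) le_rfl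
  rw [abs_neg]

end Deterministic

variable {Ω : Type*} [MeasurableSpace Ω] {μ : Measure Ω} [IsProbabilityMeasure μ] {m : ℕ}
  {C : ℤ → Matrix (Fin m) (Fin m) ℝ} {ξ Y : ℤ → Ω → EuclideanSpace ℝ (Fin m)}

namespace IsMovingAverage

theorem memLp_sampleMean (hY : IsMovingAverage C ξ Y μ) (n : ℕ) (a : Fin m) :
    MemLp (fun ω => sampleMean (fun k => Y k ω) n a) 2 μ := by
  simp_rw [sampleMean_apply, div_eq_mul_inv]
  exact (memLp_finsetSum _ fun k _ => hY.memLp_coord k a).mul_const _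

theorem integrable_sampleAutocov (hY : IsMovingAverage C ξ Y μ) (n h : ℕ) (a b : Fin m) :
    Integrable (fun ω => sampleAutocov (fun k => Y k ω) n h a b) μ := by
  simp_rw [sampleAutocov_apply]
  exact (integrable_finsetSum _ fun k _ => ((hY.memLp_coord _ a).sub
    (hY.memLp_sampleMean n a)).integrable_mul ((hY.memLp_coord _ b).sub
      (hY.memLp_sampleMean n b))).const_mul _

theorem integrable_mul (hY : IsMovingAverage C ξ Y μ) (k l : ℤ) (a b : Fin m) :
    Integrable (fun ω => Y k ω a * Y l ω b) μ :=
  (hY.memLp_coord k a).integrable_mul (hY.memLp_coord l b)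

/-- Each correction is a product of two partial sums of length at most `n`, of L¹ norm `O(n)`,
divided by `n`. The term with `h` appears because only `n - h` copies of the autocovariance are
subtracted. -/
theorem exists_integral_abs_sqrt_mul_sampleAutocov_sub_le (hY : IsMovingAverage C ξ Y μ) (h : ℕ)
    (a b : Fin m) : ∃ c : ℝ, ∀ n : ℕ, h ≤ n → 0 < n →
    ∫ ω, |√(n : ℝ) * (sampleAutocov (fun k => Y k ω) n h a b - autocov μ Y h a b)
        - (√(n : ℝ))⁻¹ * ∑ k ∈ Finset.Icc (1 : ℤ) (n - h),
          (Y k ω a * Y (k + h) ω b - autocov μ Y h a b)| ∂μ ≤ (√(n : ℝ))⁻¹ * c := by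
  set K := (∑' q : (ℤ × Fin m) × (ℤ × Fin m), |C q.1.1 a q.1.2 * C q.2.1 b q.2.2|)
    * ∫ ω, ‖ξ 1 ω‖ ^ 2 ∂μ with hK
  refine ⟨K + K + K + h * |autocov μ Y h a b|, fun n hn hn0 => ?_⟩
  have hn' : (0 : ℝ) < n := by exact_mod_cast hn0
  have hi : ∀ I I' : Finset ℤ, Integrable
      (fun ω => |(∑ k ∈ I, Y k ω a) * ∑ l ∈ I', Y l ω b| / n) μ := fun I I' =>
    (hY.integrable_sum_mul_sum I I' a b).abs.div_const _
  have hb : ∀ I I' : Finset ℤ, I.card ≤ n → I'.card ≤ n →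
      ∫ ω, |(∑ k ∈ I, Y k ω a) * ∑ l ∈ I', Y l ω b| / n ∂μ ≤ K := by
    intro I I' hI hI'
    rw [integral_div, div_le_iff₀ hn', hK]
    exact (hY.integral_abs_sum_mul_sum_le hI hI' a b).trans_eq (by ring)
  have c1 : (Finset.Icc (1 : ℤ) (n - h)).card ≤ n := by rw [Int.card_Icc]; omega
  have c2 : (Finset.Icc (1 : ℤ) n).card ≤ n := by rw [Int.card_Icc]; omega
  have c3 : ((Finset.Icc (1 : ℤ) (n - h)).map (addRightEmbedding (h : ℤ))).card ≤ n := by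
    rwa [Finset.card_map]
  refine (integral_mono_of_nonneg (Eventually.of_forall fun ω => abs_nonneg _)
    (((((hi _ _).add (hi _ _)).add (hi _ _)).add (integrable_const _)).const_mul _)
    (Eventually.of_forall fun ω => abs_sqrt_mul_sampleAutocov_sub_le (fun k => Y k ω) hn hn0 a b
      (autocov μ Y h a b))).trans ?_
  rw [integral_const_mul]
  refine mul_le_mul_of_nonneg_left ?_ (inv_nonneg.2 (Real.sqrt_nonneg _))
  rw [integral_add' (((hi _ _).add (hi _ _)).add (hi _ _)) (integrable_const _),
    integral_add' ((hi _ _).add (hi _ _)) (hi _ _), integral_add' (hi _ _) (hi _ _)]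
  simp only [integral_const, probReal_univ, one_smul]
  gcongr
  · exact hb _ _ c1 c2
  · exact hb _ _ c2 c3
  · exact hb _ _ c2 c2

theorem tendsto_integral_abs_sqrt_mul_sampleAutocov_sub (hY : IsMovingAverage C ξ Y μ) (h : ℕ)
    (a b : Fin m) :
    Tendsto (fun n : ℕ => ∫ ω, |√(n : ℝ) * (sampleAutocov (fun k => Y k ω) n h a b
          - autocov μ Y h a b) - (√(n : ℝ))⁻¹ * ∑ k ∈ Finset.Icc (1 : ℤ) (n - h),
          (Y k ω a * Y (k + h) ω b - autocov μ Y h a b)| ∂μ) atTop (𝓝 0) := by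
  obtain ⟨c, hc⟩ := hY.exists_integral_abs_sqrt_mul_sampleAutocov_sub_le h a b
  have h1 : Tendsto (fun n : ℕ => (√(n : ℝ))⁻¹ * c) atTop (𝓝 0) := by
    simpa using (tendsto_inv_atTop_zero.comp
      (Real.tendsto_sqrt_atTop.comp tendsto_natCast_atTop_atTop)).mul_const c
  refine squeeze_zero' (Eventually.of_forall fun n => integral_nonneg fun ω => abs_nonneg _) ?_ h1
  filter_upwards [eventually_ge_atTop h, eventually_gt_atTop 0] with n hn hn0
  exact hc n hn hn0

end IsMovingAverage

end

/-! ### Linear combinations of coordinates and the Cramér–Wold device. -/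

theorem hasSum_prod_of_fintype {ι κ : Type*} [Fintype ι] {f : ι × κ → ℝ} {s : ι → ℝ}
    (h : ∀ i, HasSum (fun q => f (i, q)) (s i)) : HasSum f (∑ i, s i) := by
  classical
  have h1 : ∀ i, HasSum (fun p : ι × κ => if p.1 = i then f p else 0) (s i) := by
    intro i
    refine (Function.Injective.hasSum_iff (Prod.mk_right_injective i) ?_).1 ?_
    · rintro ⟨j, q⟩ hjq
      refine if_neg fun hj => hjq ⟨q, ?_⟩
      rw [← show j = i from hj]
    · simpa [Function.comp_def] using h i
  simpa using hasSum_sum (s := Finset.univ) fun i _ => h1 i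

theorem charFun_map_toLp {Ω ι : Type*} [MeasurableSpace Ω] [Fintype ι] {μ : Measure Ω}
    {X : ι → Ω → ℝ} (hX : ∀ i, AEMeasurable (X i) μ) (t : EuclideanSpace ℝ ι) :
    charFun (μ.map fun ω => WithLp.toLp 2 fun i => X i ω) t
      = charFun (μ.map fun ω => ∑ i, t i * X i ω) 1 := by
  have h1 : AEMeasurable (fun ω => WithLp.toLp 2 fun i => X i ω) μ :=
    (PiLp.continuous_toLp 2 fun _ : ι => ℝ).measurable.comp_aemeasurable (aemeasurable_pi_lambda _ hX)
  have h2 : AEMeasurable (fun ω => ∑ i, t i * X i ω) μ :=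
    Finset.aemeasurable_fun_sum _ fun i _ => (hX i).const_mul _
  rw [charFun_apply, charFun_apply_real, integral_map h1 (by fun_prop),
    integral_map h2 (by fun_prop)]
  refine integral_congr_ae (Eventually.of_forall fun ω => ?_)
  simp [PiLp.inner_apply]

/-- The **Cramér–Wold device**. -/
theorem tendstoInDistribution_toLp_of_charFun {Ω Ω' ι : Type*} [MeasurableSpace Ω]
    [MeasurableSpace Ω'] [Fintype ι] {μ : Measure Ω} [IsProbabilityMeasure μ] {μ' : Measure Ω'}
    [IsProbabilityMeasure μ'] {X : ℕ → ι → Ω → ℝ} {Z : ι → Ω' → ℝ}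
    (hX : ∀ n i, AEMeasurable (X n i) μ) (hZ : ∀ i, AEMeasurable (Z i) μ')
    (h : ∀ t : ι → ℝ, Tendsto (fun n => charFun (μ.map fun ω => ∑ i, t i * X n i ω) 1) atTop
      (𝓝 (charFun (μ'.map fun ω => ∑ i, t i * Z i ω) 1))) :
    TendstoInDistribution (fun n ω => WithLp.toLp 2 fun i => X n i ω) atTop
      (fun ω => WithLp.toLp 2 fun i => Z i ω) (fun _ => μ) μ' where
  forall_aemeasurable n := (PiLp.continuous_toLp 2 fun _ : ι => ℝ).measurable.comp_aemeasurable
    (aemeasurable_pi_lambda _ (hX n))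
  aemeasurable_limit := (PiLp.continuous_toLp 2 fun _ : ι => ℝ).measurable.comp_aemeasurable
    (aemeasurable_pi_lambda _ hZ)
  tendsto := by
    refine ProbabilityMeasure.tendsto_iff_tendsto_charFun.2 fun t => ?_
    simp only [ProbabilityMeasure.coe_mk]
    rw [charFun_map_toLp hZ t]
    simp_rw [charFun_map_toLp (hX _) t]
    exact h t

/-! ### Joint convergence over entries and lags. -/

section

variable {Ω : Type*} [MeasurableSpace Ω] {μ : Measure Ω} [IsProbabilityMeasure μ]
  {Ω' : Type*} [MeasurableSpace Ω'] {μ' : Measure Ω'} [IsProbabilityMeasure μ'] {m : ℕ}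
  {C : ℤ → Matrix (Fin m) (Fin m) ℝ} {ξ Y : ℤ → Ω → EuclideanSpace ℝ (Fin m)}
  {S : Matrix (Fin m) (Fin m) ℝ} {V : Matrix (Fin m × Fin m) (Fin m × Fin m) ℝ}
  {W : Ω' → Matrix (Fin m) (Fin m) ℝ} {N : ℕ+ → Ω' → Matrix (Fin m) (Fin m) ℝ}

theorem IsLimitNoise.aemeasurable_limitMat (hWN : IsLimitNoise V W N μ')
    (hV : ∀ a b a' b', V (b, a) (b', a') = V (a, b) (a', b')) (hC_neg : ∀ j < 0, C j = 0)
    (hC : Summable fun j : ℤ => opNorm (C j)) (h : ℕ) (a b : Fin m) :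
    AEMeasurable (fun ω => limitMat C S (W ω) (fun r => N r ω) h a b) μ' := by
  have h1 := hWN.ae_limitMat_apply_eq_tsum (S := S) hV hC_neg hC h a b
  refine AEMeasurable.congr (AEMeasurable.tsum fun q =>
    ((hWN.hasGaussianLaw_laggedMat _ _ _).integrable.aemeasurable.const_mul _))
    (h1.mono fun ω hω => hω.tsum_eq)

/-- The coefficients `t i` are absorbed into the weights of one series over `ι × J`, so a single use
of `tendsto_charFun_tsum_window` treats all entries and lags together. -/
theorem IsMovingAverage.tendsto_charFun_sum_sampleAutocov {ι : Type*} [Fintype ι]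
    (hY : IsMovingAverage C ξ Y μ)
    (hS : S * S.transpose = expMat μ fun ω => outerProd (ξ 1 ω) (ξ 1 ω))
    (hWN : IsLimitNoise (upsilonStar μ (ξ 1)) W N μ') (h : ι → ℕ) (a b : ι → Fin m) (t : ι → ℝ) :
    Tendsto (fun n : ℕ => charFun (μ.map fun ω => ∑ i, t i * (√(n : ℝ) *
        (sampleAutocov (fun k => Y k ω) n (h i) (a i) (b i) - autocov μ Y (h i) (a i) (b i)))) 1)
      atTop (𝓝 (charFun (μ'.map fun ω => ∑ i, t i *
        limitMat C S (W ω) (fun r => N r ω) (h i) (a i) (b i)) 1)) := by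
  have hV : ∀ a b a' b', upsilonStar μ (ξ 1) (b, a) (b', a') = upsilonStar μ (ξ 1) (a, b) (a', b') :=
    fun a b a' b' => by simp only [upsilonStar_apply, mul_comm]
  let J := (ℤ × Fin m) × (ℤ × Fin m)
  let w : ι × J → ℝ := fun q =>
    t q.1 * (C q.2.1.1 (a q.1) q.2.1.2 * C q.2.2.1 (b q.1) q.2.2.2)
  have hw : Summable fun q => |w q| := by
    refine (hasSum_prod_of_fintype
      (s := fun i => |t i| * ∑' q : J, |C q.1.1 (a i) q.1.2 * C q.2.1 (b i) q.2.2|)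
      fun i => ?_).summable
    simp only [w, abs_mul (t i)]
    exact (summable_abs_coeff_mul hY.summable_int (a i) (b i)).hasSum.mul_left |t i|
  have key := tendsto_charFun_tsum_window hY.noise hS hWN hw (fun q => h q.1)
    (fun q => -q.2.1.1) (fun q => h q.1 - q.2.2.1) (fun q => q.2.1.2) (fun q => q.2.2.2) 1
  let X : ℕ → Ω → ℝ := fun n ω => ∑ i, t i * ((√(n : ℝ))⁻¹ * ∑ k ∈ Finset.Icc (1 : ℤ) (n - h i),
    (Y k ω (a i) * Y (k + h i) ω (b i) - autocov μ Y (h i) (a i) (b i)))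
  have e1 : ∀ n : ℕ, (fun ω => ∑' q, w q * ((√(n : ℝ))⁻¹ * ∑ k ∈ Finset.Icc (1 : ℤ) (n - h q.1),
      centeredProd ξ μ (k + -q.2.1.1) q.2.1.2 (k + (h q.1 - q.2.2.1)) q.2.2.2 ω)) =ᵐ[μ] X n := by
    intro n
    filter_upwards [ae_all_iff.2 fun i => hY.ae_hasSum_sum_centered
      (Finset.Icc (1 : ℤ) (n - h i)) (h i) (a i) (b i)] with ω hω
    refine (hasSum_prod_of_fintype fun i => ?_).tsum_eq
    refine (congrArg (fun f => HasSum f _) (funext fun q => ?_)).mpr (((hω i).mul_left (√(n : ℝ))⁻¹).mul_left (t i))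
    simp only [w]
    ring
  have e2 : (fun ω => ∑' q, w q * laggedMat S (W ω) (fun r => N r ω)
      (-q.2.1.1 - (h q.1 - q.2.2.1)).natAbs
      (orderedCoords (-q.2.1.1 - (h q.1 - q.2.2.1)) q.2.1.2 q.2.2.2).1
      (orderedCoords (-q.2.1.1 - (h q.1 - q.2.2.1)) q.2.1.2 q.2.2.2).2) =ᵐ[μ']
      fun ω => ∑ i, t i * limitMat C S (W ω) (fun r => N r ω) (h i) (a i) (b i) := by
    filter_upwards [ae_all_iff.2 fun i => hWN.ae_limitMat_apply_eq_tsum (S := S) hV hY.causal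
      hY.summable_int (h i) (a i) (b i)] with ω hω
    refine (hasSum_prod_of_fintype fun i => ?_).tsum_eq
    refine (congrArg (fun f => HasSum f _) (funext fun q => ?_)).mpr ((hω i).mul_left (t i))
    simp only [w]
    ring
  rw [Measure.map_congr e2] at key
  simp_rw [Measure.map_congr (e1 _)] at key
  have hi : ∀ (n : ℕ) i, Integrable (fun ω => t i * (√(n : ℝ) *
      (sampleAutocov (fun k => Y k ω) n (h i) (a i) (b i)
        - autocov μ Y (h i) (a i) (b i)))) μ := fun n i =>
    (((hY.integrable_sampleAutocov n (h i) (a i) (b i)).sub (integrable_const _)).const_mul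
      _).const_mul _
  have hi' : ∀ (n : ℕ) i, Integrable (fun ω => t i * ((√(n : ℝ))⁻¹ *
      ∑ k ∈ Finset.Icc (1 : ℤ) (n - h i),
        (Y k ω (a i) * Y (k + h i) ω (b i) - autocov μ Y (h i) (a i) (b i)))) μ := fun n i =>
    ((integrable_finsetSum _ fun k _ => (hY.integrable_mul _ _ _ _).sub
      (integrable_const _)).const_mul _).const_mul _
  -- The series gave the limit for products centred at the true autocovariance; the sample version
  -- differs from them by a quantity tending to `0` in L¹.
  refine tendsto_charFun_of_integral_abs_sub (fun n => integrable_finsetSum _ fun i _ => hi n i)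
    (fun n => integrable_finsetSum _ fun i _ => hi' n i) key ?_
  have h1 := tendsto_finsetSum (Finset.univ : Finset ι) fun i _ =>
    (hY.tendsto_integral_abs_sqrt_mul_sampleAutocov_sub (h i) (a i) (b i)).const_mul |t i|
  simp only [mul_zero, Finset.sum_const_zero] at h1
  refine squeeze_zero (fun n => integral_nonneg fun ω => abs_nonneg _) (fun n => ?_) h1
  simp_rw [← Finset.sum_sub_distrib, ← mul_sub]
  have hd : ∀ i, Integrable (fun ω => |t i| * |√(n : ℝ) *
      (sampleAutocov (fun k => Y k ω) n (h i) (a i) (b i) - autocov μ Y (h i) (a i) (b i))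
        - (√(n : ℝ))⁻¹ * ∑ k ∈ Finset.Icc (1 : ℤ) (n - h i),
        (Y k ω (a i) * Y (k + h i) ω (b i) - autocov μ Y (h i) (a i) (b i))|) μ := fun i => by
    simp_rw [← abs_mul, mul_sub (t i)]
    exact ((hi n i).sub (hi' n i)).abs
  simp_rw [← integral_const_mul]
  rw [← integral_finsetSum _ fun i _ => hd i]
  refine integral_mono_of_nonneg (Eventually.of_forall fun ω => abs_nonneg _)
    (integrable_finsetSum _ fun i _ => hd i) (Eventually.of_forall fun ω => ?_)
  simp_rw [← abs_mul]
  exact Finset.abs_sum_le_sum_abs _ _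

end

theorem theorem5p1
    {Ω : Type*} [MeasurableSpace Ω] (μ : Measure Ω) [IsProbabilityMeasure μ]
    {Ω' : Type*} [MeasurableSpace Ω'] (μ' : Measure Ω') [IsProbabilityMeasure μ']
    (m : ℕ)
    -- the iid noise, centred and with finite fourth moment
    (ξ : ℤ → Ω → EuclideanSpace ℝ (Fin m))
    (hξ_indep : iIndepFun ξ μ)
    (hξ_ident : ∀ k, IdentDistrib (ξ k) (ξ 1) μ μ)
    (hξ_moment : MemLp (ξ 1) 4 μ)
    (hξ_mean : ∫ ω, ξ 1 ω ∂μ = 0)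
    -- a square root of the noise covariance
    (S : Matrix (Fin m) (Fin m) ℝ)
    (hS : S * S.transpose = expMat μ fun ω => outerProd (ξ 1 ω) (ξ 1 ω))
    -- the coefficients
    (C : ℤ → Matrix (Fin m) (Fin m) ℝ)
    (hC_neg : ∀ j < 0, C j = 0)
    (hC_sq : Summable fun j : ℕ => (j : ℝ) * opNorm (C j) ^ 2)
    (hC_abs : Summable fun j : ℕ => opNorm (C j))
    -- the moving average process
    (Y : ℤ → Ω → EuclideanSpace ℝ (Fin m))
    (hY : ∀ k : ℤ, Y k =ᵐ[μ] fun ω => ∑' j : ℕ, applyMat (C j) (ξ (k - (j : ℤ)) ω))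
    -- the Gaussian ingredients of the limit
    (W : Ω' → Matrix (Fin m) (Fin m) ℝ)
    (hW : HasLaw (fun ω => WithLp.toLp 2 (W ω).vec)
      (multivariateGaussian 0 (upsilonStar μ (ξ 1))) μ')
    (N : ℕ+ → Ω' → Matrix (Fin m) (Fin m) ℝ)
    (hN_law : ∀ r i j, HasLaw (fun ω => N r ω i j) (gaussianReal 0 1) μ')
    (hN_indep : iIndepFun
      (fun (p : ℕ+ × Fin m × Fin m) (ω : Ω') => N p.1 ω p.2.1 p.2.2) μ')
    (hWN : IndepFun W (fun ω r => N r ω) μ')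
    -- the finite set of lags
    (H : Finset ℕ) :
    -- the process is well defined, with finite second moments
    (∀ k : ℤ, ∀ᵐ ω ∂μ, Summable fun j : ℕ => ‖applyMat (C j) (ξ (k - (j : ℤ)) ω)‖) ∧
    (∀ k : ℤ, MemLp (Y k) 2 μ) ∧
    -- the series in the limit converge absolutely
    (∀ h ∈ H, ∀ᵐ ω ∂μ',
      (Summable fun j : ℕ => opNorm (diagTerm C (W ω) h j)) ∧
      (Summable fun q : ℕ × ℕ+ => opNorm (forwardTerm C S (fun r => N r ω) h q.1 q.2)) ∧
      (Summable fun q : ℕ × ℕ+ => opNorm (backwardTerm C S (fun r => N r ω) h q.1 q.2))) ∧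
    -- joint convergence in distribution over the lags in `H`
    TendstoInDistribution
      (fun (n : ℕ) (ω : Ω) (h : H) =>
        √(n : ℝ) • (sampleAutocov (fun k => Y k ω) n h - autocov μ Y ((h : ℕ) : ℤ)))
      atTop
      (fun (ω : Ω') (h : H) => limitMat C S (W ω) (fun r => N r ω) h)
      (fun _ => μ) μ' := by
  have hξ : IsNoise ξ μ := ⟨hξ_indep, hξ_ident, hξ_moment, hξ_mean⟩
  have hYm : IsMovingAverage C ξ Y μ := ⟨hξ, hC_neg, hC_abs, hY⟩
  have hlim : IsLimitNoise (upsilonStar μ (ξ 1)) W N μ' :=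
    ⟨hξ.posSemidef_upsilonStar, hW, hN_law, hN_indep, hWN⟩
  have hV : ∀ a b a' b', upsilonStar μ (ξ 1) (b, a) (b', a') = upsilonStar μ (ξ 1) (a, b) (a', b') :=
    fun a b a' b' => by simp only [upsilonStar_apply, mul_comm]
  refine ⟨hYm.ae_summable_norm, hYm.memLp, fun h _ => ?_, ?_⟩
  · filter_upwards [hlim.ae_summable_limitTerm (S := S) hV hYm.summable_int h] with ω hω
    exact ⟨summable_opNorm_diagTerm hω, summable_opNorm_forwardTerm hω,
      summable_opNorm_backwardTerm hω⟩
  · let X : ℕ → H × Fin m × Fin m → Ω → ℝ := fun n i ω => √(n : ℝ) *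
      (sampleAutocov (fun k => Y k ω) n i.1 i.2.1 i.2.2
        - autocov μ Y ((i.1 : ℕ) : ℤ) i.2.1 i.2.2)
    let Z : H × Fin m × Fin m → Ω' → ℝ := fun i ω =>
      limitMat C S (W ω) (fun r => N r ω) i.1 i.2.1 i.2.2
    have hX : ∀ n i, AEMeasurable (X n i) μ := fun n i =>
      (((hYm.integrable_sampleAutocov n i.1 i.2.1 i.2.2).sub
        (integrable_const _)).const_mul _).aemeasurable
    have hZ : ∀ i, AEMeasurable (Z i) μ' := fun i =>
      hlim.aemeasurable_limitMat hV hC_neg hYm.summable_int i.1 i.2.1 i.2.2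
    have ht := hYm.tendsto_charFun_sum_sampleAutocov hS hlim
      (fun i : H × Fin m × Fin m => (i.1 : ℕ)) (fun i => i.2.1) (fun i => i.2.2)
    have h1 := tendstoInDistribution_toLp_of_charFun hX hZ ht
    -- Convergence was obtained for the flattened vector of all entries; continuous mapping restores
    -- the family of matrices.
    have hg : Continuous fun (x : EuclideanSpace ℝ (H × Fin m × Fin m)) (h : H) =>
        (Matrix.of fun a b => x (h, a, b) : Matrix (Fin m) (Fin m) ℝ) :=
      continuous_pi fun h => continuous_pi fun a => continuous_pi fun b => by fun_prop
    exact h1.continuous_comp hg
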